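/- Let $G$ be a countable discrete amenable group acting by homeomorphisms on a compact metrizable space $X$, and suppose the action is free: $gx = x$ for some $x \in X$ only if $g = 1$. Let $H$ be an infinite normal subgroup of $G$. If the restricted action of $H$ on $X$ is almost finite, then the action of $G$ on $X$ is almost finite. Here the terms have the following meaning. For an action of a discrete group $\Gamma$ on $X$ and sets $A, B \subseteq X$, write $A \precsim_\Gamma B$ if for every compact $C \subseteq A$ there are finitely many open sets $U_1, \dots, U_m \subseteq X$ with $C \subseteq \bigcup_{i} U_i$ and elements $g_1, \dots, g_m \in \Gamma$ such that $g_1U_1, \dots, g_mU_m$ are pairwise disjoint subsets of $B$. For a nonempty finite set $K \subseteq \Gamma$ and $\varepsilon > 0$, a finite set $S \subseteq \Gamma$ is $(K,\varepsilon)$-invariant if $|S \mathbin{\Delta} KS| < \varepsilon |S|$; the group $\Gamma$ is amenable if it has $(K,\varepsilon)$-invariant finite subsets for all such $K$ and $\varepsilon$. Fix a (not necessarily invariant) metric on $X$ that is compatible with the topology. The action of $\Gamma$ on $X$ is almost finite if for every nonempty finite set $K \subseteq \Gamma$ and every $\varepsilon > 0$ there are $n \geq 0$, finite sets $S_1, \dots,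 S_n \subseteq \Gamma$ and open sets $V_1, \dots, V_n \subseteq X$ such that 1. each $S_i$ is $(K,\varepsilon)$-invariant; 2. the sets $sV_i$, for $1 \le i \le n$ and $s \in S_i$, are pairwise disjoint (for distinct pairs $(i,s)$) and have diameter less than $\varepsilon$; 3. there are subsets $S_i' \subseteq S_i$ with $|S_i'| < \varepsilon |S_i|$ such that $$X \setminus \bigsqcup_{i=1}^n S_iV_i \precsim_\Gamma \bigsqcup_{i=1}^n S_i'V_i.$$ -/

import Mathlib

section AlmostFiniteness

open scoped Pointwise symmDiff

open Classical in
/-- The finite set `S` is `(K, ε)`-invariant: `|S ∆ KS| < ε |S|`. In particular `S` is nonempty. -/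
def IsInvariantFor {G : Type*} [Group G] (K : Finset G) (ε : ℝ) (S : Finset G) : Prop :=
  ((S ∆ (K * S)).card : ℝ) < ε * (S.card : ℝ)

/-- Amenability of a discrete group, by the Følner condition: there are `(K, ε)`-invariant finite
sets for every nonempty finite set `K` and every `ε > 0`. -/
def IsAmenableGroup (G : Type*) [Group G] : Prop :=
  ∀ K : Finset G, K.Nonempty → ∀ ε : ℝ, 0 < ε → ∃ S : Finset G, IsInvariantFor K ε S

/-- `A` is dynamically subequivalent to `B`: every compact subset of `A` is covered by finitely
many open sets that the group can move to pairwise disjoint subsets of `B`. The sets `A` and `B`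
are arbitrary, since the left-hand side is closed in the definition of almost finiteness. -/
def DynSubequiv (G : Type*) {X : Type*} [Group G] [TopologicalSpace X] [MulAction G X]
    (A B : Set X) : Prop :=
  ∀ C : Set X, C ⊆ A → IsCompact C →
    ∃ (n : ℕ) (U : Fin n → Set X) (g : Fin n → G),
      (∀ i, IsOpen (U i)) ∧ C ⊆ ⋃ i, U i ∧ (∀ i, g i • U i ⊆ B) ∧
      Pairwise fun i j => Disjoint (g i • U i) (g j • U j)

/-- Almost finiteness of an action on a compact metric space, with respect to the given metric.
The set `K` is taken to be nonempty because no finite set is `(∅, ε)`-invariant for `ε ≤ 1`. -/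
def IsAlmostFinite (G X : Type*) [Group G] [MetricSpace X] [MulAction G X] : Prop :=
  ∀ K : Finset G, K.Nonempty → ∀ ε : ℝ, 0 < ε →
    ∃ (n : ℕ) (S : Fin n → Finset G) (V : Fin n → Set X),
      (∀ i, IsInvariantFor K ε (S i)) ∧
      (∀ i, IsOpen (V i)) ∧
      (∀ i, ∀ s ∈ S i, ∀ j, ∀ t ∈ S j, (i, s) ≠ (j, t) → Disjoint (s • V i) (t • V j)) ∧
      (∀ i, ∀ s ∈ S i, Metric.diam (s • V i) < ε) ∧
      ∃ S' : Fin n → Finset G,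
        (∀ i, S' i ⊆ S i) ∧
        (∀ i, ((S' i).card : ℝ) < ε * ((S i).card : ℝ)) ∧
        DynSubequiv G (⋃ i, ⋃ s ∈ S i, s • V i)ᶜ (⋃ i, ⋃ s ∈ S' i, s • V i)

end AlmostFiniteness

open scoped Pointwise symmDiff Classical
open Set

universe u v w

/-! Densities are compared without invariant measures. `AvgLE Γ φ ψ` certifies that `φ` is at most
`ψ` in every `Γ`-invariant average, by an explicit finite combination of coboundaries. Such a
certificate with some slack turns into a pointwise inequality between sums over sufficiently
invariant finite sets (`AvgLE.sum_le`). The theorem then splits into a construction and a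
comparison.

Construction (`exists_castle_sparse_compl`). Almost finiteness of `H` supplies, at each small
diameter, a fixed number `N` of disjoint open sets whose complement `R` has density as small as
desired (`exists_disjoint_open_small`). These sets behave like clopen colours off `R`. By freeness,
tiles of `G` centred in one colour are disjoint, so the greedy Ornstein–Weiss construction runs
through finitely many Følner sets and all colours; each scale shrinks the uncovered part by a factor
of almost `1 - ε` (`QuasiTiling.uncovered_le`). Every set that arises is locally constant off `P •
R` for a finite set `P` depending only on the Følner sets and `N`. As `N` is chosen before the
density of `R`, the set `P • R` can be made sparse, and replacing the bases by their interiors costs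
little.

Comparison (`dynSubequiv_of_count_lt`). Choosing about `ε / 2` of each shape as `S'` makes the
remainder sparser than the castle of `S'`, so along a Følner set `F` of `G` every point visits the
remainder less often. To use only castles of `H`, colour the levels of one such castle evenly by `F`
and pull a level of colour `f` back by `f⁻¹`. Each set is thereby divided evenly among its
`F`-translates, and normality of `H` keeps the density estimates valid modulo `H`-coboundaries after
translation. A second, much finer castle of `H` converts them into counts in each tower, and an
injection of sources into targets tells how to move the remainder. -/

/-! ### Averages modulo coboundaries -/

/-- The span of the functions `x ↦ χ (k • x) - χ x` with `k ∈ Γ` and `χ` bounded. -/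
def coboundaries {G : Type u} [Group G] (Γ : Subgroup G) (X : Type v) [MulAction G X] :
    Submodule ℝ (X → ℝ) :=
  Submodule.span ℝ {ν | ∃ k ∈ Γ, ∃ χ : X → ℝ, (∃ C, ∀ x, |χ x| ≤ C) ∧
    ν = fun x => χ (k • x) - χ x}

/-- `φ ≤ ψ` up to a coboundary; in particular `∫ φ ≤ ∫ ψ` for all `Γ`-invariant means. -/
def AvgLE {G : Type u} [Group G] {X : Type v} [MulAction G X] (Γ : Subgroup G)
    (φ ψ : X → ℝ) : Prop :=
  ∃ ν ∈ coboundaries Γ X, ∀ x, φ x ≤ ψ x + ν x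

/-- The real-valued indicator function of a set. -/
noncomputable def ind {X : Type v} (A : Set X) (x : X) : ℝ := if x ∈ A then 1 else 0

section Calculus

variable {G : Type u} [Group G] {X : Type v} [MulAction G X] {Γ : Subgroup G}

lemma ind_nonneg (A : Set X) (x : X) : 0 ≤ ind A x := by unfold ind; split_ifs <;> norm_num

lemma ind_le_one (A : Set X) (x : X) : ind A x ≤ 1 := by unfold ind; split_ifs <;> norm_num

lemma ind_of_mem {A : Set X} {x : X} (h : x ∈ A) : ind A x = 1 := if_pos h

lemma ind_of_notMem {A : Set X} {x : X} (h : x ∉ A) : ind A x = 0 := if_neg h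

lemma ind_mono {A B : Set X} (h : A ⊆ B) (x : X) : ind A x ≤ ind B x := by
  by_cases hx : x ∈ A
  · rw [ind_of_mem hx, ind_of_mem (h hx)]
  · rw [ind_of_notMem hx]; exact ind_nonneg _ _

lemma ind_smul_set (g : G) (A : Set X) (x : X) : ind (g • A) x = ind A (g⁻¹ • x) := by
  unfold ind; simp only [mem_smul_set_iff_inv_smul_mem]

lemma abs_ind_le_one (A : Set X) (x : X) : |ind A x| ≤ 1 := by
  rw [abs_of_nonneg (ind_nonneg _ _)]; exact ind_le_one _ _

lemma ind_le_sum_of_mem {κ : Type*} [Fintype κ] {A : Set X} {U : κ → Set X}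
    (h : A ⊆ ⋃ k, U k) (x : X) : ind A x ≤ ∑ k, ind (U k) x := by
  by_cases hx : x ∈ A
  · obtain ⟨k, hk⟩ := mem_iUnion.1 (h hx)
    rw [ind_of_mem hx, ← ind_of_mem hk]
    exact Finset.single_le_sum (f := fun k => ind (U k) x) (fun k _ => ind_nonneg _ _)
      (Finset.mem_univ k)
  · rw [ind_of_notMem hx]; exact Finset.sum_nonneg fun k _ => ind_nonneg _ _

lemma sum_ind_le_of_pairwise_disjoint {κ : Type*} {s : Finset κ} {B : Set X} {U : κ → Set X}
    (hsub : ∀ k ∈ s, U k ⊆ B) (hd : ∀ k ∈ s, ∀ l ∈ s, k ≠ l → Disjoint (U k) (U l)) (x : X) :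
    ∑ k ∈ s, ind (U k) x ≤ ind B x := by
  by_cases hx : ∃ k ∈ s, x ∈ U k
  · obtain ⟨k, hks, hk⟩ := hx
    rw [Finset.sum_eq_single_of_mem k hks, ind_of_mem hk, ind_of_mem (hsub k hks hk)]
    intro l hl hlk
    exact ind_of_notMem fun h => disjoint_left.1 (hd l hl k hks hlk) h hk
  · push Not at hx
    rw [Finset.sum_eq_zero fun k hk => ind_of_notMem (hx k hk)]
    exact ind_nonneg _ _

namespace AvgLE

variable {φ ψ θ φ' ψ' : X → ℝ}

lemma of_le (h : ∀ x, φ x ≤ ψ x) : AvgLE Γ φ ψ :=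
  ⟨0, Submodule.zero_mem _, fun x => by simpa using h x⟩

lemma trans (h : AvgLE Γ φ ψ) (h' : AvgLE Γ ψ θ) : AvgLE Γ φ θ := by
  obtain ⟨ν, hν, hl⟩ := h
  obtain ⟨ν', hν', hl'⟩ := h'
  refine ⟨ν + ν', Submodule.add_mem _ hν hν', fun x => ?_⟩
  have := hl x; have := hl' x; simp only [Pi.add_apply]; linarith

lemma add (h : AvgLE Γ φ ψ) (h' : AvgLE Γ φ' ψ') :
    AvgLE Γ (fun x => φ x + φ' x) (fun x => ψ x + ψ' x) := by
  obtain ⟨ν, hν, hl⟩ := h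
  obtain ⟨ν', hν', hl'⟩ := h'
  refine ⟨ν + ν', Submodule.add_mem _ hν hν', fun x => ?_⟩
  have := hl x; have := hl' x; simp only [Pi.add_apply]; linarith

lemma const_mul {c : ℝ} (hc : 0 ≤ c) (h : AvgLE Γ φ ψ) :
    AvgLE Γ (fun x => c * φ x) (fun x => c * ψ x) := by
  obtain ⟨ν, hν, hl⟩ := h
  refine ⟨c • ν, Submodule.smul_mem _ _ hν, fun x => ?_⟩
  simp only [Pi.smul_apply, smul_eq_mul, ← mul_add]
  exact mul_le_mul_of_nonneg_left (hl x) hc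

lemma sum {κ : Type*} {s : Finset κ} {a b : κ → X → ℝ} (h : ∀ k ∈ s, AvgLE Γ (a k) (b k)) :
    AvgLE Γ (fun x => ∑ k ∈ s, a k x) (fun x => ∑ k ∈ s, b k x) := by
  induction s using Finset.induction_on with
  | empty => exact of_le fun x => by simp
  | insert k s hk ih =>
    simp only [Finset.sum_insert hk]
    exact (h k (Finset.mem_insert_self _ _)).add
      (ih fun l hl => h l (Finset.mem_insert_of_mem hl))

lemma mono {Γ' : Subgroup G} (hΓ : Γ ≤ Γ') (h : AvgLE Γ φ ψ) : AvgLE Γ' φ ψ := by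
  obtain ⟨ν, hν, hl⟩ := h
  refine ⟨ν, Submodule.span_mono ?_ hν, hl⟩
  rintro _ ⟨k, hk, h⟩
  exact ⟨k, hΓ hk, h⟩

lemma smul_le {k : G} (hk : k ∈ Γ) {C : ℝ} (hC : ∀ x, |φ x| ≤ C) :
    AvgLE Γ (fun x => φ (k • x)) φ :=
  ⟨fun x => φ (k • x) - φ x, Submodule.subset_span ⟨k, hk, φ, ⟨C, hC⟩, rfl⟩,
    fun x => by simp⟩

lemma le_smul {k : G} (hk : k ∈ Γ) {C : ℝ} (hC : ∀ x, |φ x| ≤ C) :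
    AvgLE Γ φ (fun x => φ (k • x)) := by
  have := smul_le (φ := fun x => φ (k • x)) (Γ.inv_mem hk) (fun x => hC (k • x))
  simpa only [smul_inv_smul] using this

lemma ind_smul_le {k : G} (hk : k ∈ Γ) (A : Set X) : AvgLE Γ (ind (k • A)) (ind A) :=
  (of_le fun x => (ind_smul_set k A x).le).trans
    (smul_le (φ := ind A) (Γ.inv_mem hk) (abs_ind_le_one A))

lemma ind_le_smul {k : G} (hk : k ∈ Γ) (A : Set X) : AvgLE Γ (ind A) (ind (k • A)) :=
  (le_smul (φ := ind A) (Γ.inv_mem hk) (abs_ind_le_one A)).trans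
    (of_le fun x => (ind_smul_set k A x).ge)

/-- Precomposing a coboundary of `k` with `g` gives a coboundary of `g⁻¹ * k * g`. This is where
normality of the subgroup enters. -/
lemma comp_smul [Γ.Normal] (h : AvgLE Γ φ ψ) (g : G) :
    AvgLE Γ (fun x => φ (g • x)) (fun x => ψ (g • x)) := by
  obtain ⟨ν, hν, hl⟩ := h
  refine ⟨fun x => ν (g • x), ?_, fun x => hl (g • x)⟩
  clear hl
  unfold coboundaries at hν
  induction hν using Submodule.span_induction with
  | mem ν h =>
    obtain ⟨k, hk, χ, ⟨C, hC⟩, rfl⟩ := h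
    refine Submodule.subset_span ⟨g⁻¹ * k * g, ?_, fun x => χ (g • x), ⟨C, fun x => hC _⟩, ?_⟩
    · simpa using ‹Γ.Normal›.conj_mem k hk g⁻¹
    · funext x; simp [mul_smul]
  | zero => exact Submodule.zero_mem _
  | add a b _ _ ha hb => exact Submodule.add_mem _ ha hb
  | smul c a _ ha => exact Submodule.smul_mem _ c ha

end AvgLE

/-- Coboundaries have small averages over sufficiently invariant finite sets. -/
lemma sum_coboundary_le {ν : X → ℝ} (hν : ν ∈ coboundaries Γ X) {ε : ℝ} (hε : 0 < ε) :
    ∃ K : Finset G, (∀ k ∈ K, k ∈ Γ) ∧ ∃ η : ℝ, 0 < η ∧ ∀ E : Finset G,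
      (∀ k ∈ K, (((k • E) \ E).card : ℝ) ≤ η * E.card) →
      ∀ y : X, |∑ e ∈ E, ν (e • y)| ≤ ε * E.card := by
  unfold coboundaries at hν
  induction hν using Submodule.span_induction generalizing ε with
  | mem ν h =>
    obtain ⟨k, hk, χ, ⟨C, hC⟩, rfl⟩ := h
    refine ⟨{k}, by simpa using hk, ε / (2 * (|C| + 1)), by positivity, fun E hE y => ?_⟩
    have hE := hE k (by simp)
    have hC' : ∀ x, |χ x| ≤ |C| + 1 := fun x => (hC x).trans (by linarith [le_abs_self C])
    have h1 : ∑ e ∈ E, χ (k • e • y) = ∑ e ∈ k • E, χ (e • y) := by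
      rw [← Finset.image_smul, Finset.sum_image fun a _ b _ h => smul_left_cancel k h]
      simp [mul_smul]
    have hcard : (E \ (k • E)).card = ((k • E) \ E).card := by
      have h1 := Finset.card_sdiff_add_card_inter E (k • E)
      have h2 := Finset.card_sdiff_add_card_inter (k • E) E
      rw [Finset.inter_comm] at h2
      have h3 : (k • E).card = E.card := Finset.card_smul_finset k E
      omega
    have hb : ∀ A : Finset G, |∑ e ∈ A, χ (e • y)| ≤ (|C| + 1) * A.card := fun A =>
      (Finset.abs_sum_le_sum_abs _ _).trans
        ((Finset.sum_le_sum fun e _ => hC' (e • y)).trans (by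
          simp only [Finset.sum_const, nsmul_eq_mul]; exact (mul_comm _ _).le))
    -- The common part of `k • E` and `E` cancels; the two differences have the same size, which
    -- gives the factor `2` in the choice of the tolerance.
    rw [Finset.sum_sub_distrib, h1, Finset.sum_sdiff_sub_sum_sdiff.symm]
    refine (abs_sub _ _).trans ((add_le_add (hb _) (hb _)).trans ?_)
    rw [hcard]
    calc _ = 2 * (|C| + 1) * (((k • E) \ E).card : ℝ) := by ring
      _ ≤ 2 * (|C| + 1) * (ε / (2 * (|C| + 1)) * E.card) := by gcongr
      _ = _ := by field_simp
  | zero => exact ⟨∅, by simp, 1, one_pos, fun E _ y => by simp; positivity⟩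
  | add a b _ _ ha hb =>
    obtain ⟨K, hK, η, hη, h⟩ := ha (half_pos hε)
    obtain ⟨K', hK', η', hη', h'⟩ := hb (half_pos hε)
    refine ⟨K ∪ K', fun k hk => (Finset.mem_union.1 hk).elim (hK k) (hK' k), min η η',
      lt_min hη hη', fun E hE y => ?_⟩
    have h1 := h E (fun k hk => (hE k (Finset.mem_union_left _ hk)).trans
      (by gcongr; exact min_le_left _ _)) y
    have h2 := h' E (fun k hk => (hE k (Finset.mem_union_right _ hk)).trans
      (by gcongr; exact min_le_right _ _)) y
    simp only [Pi.add_apply, Finset.sum_add_distrib]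
    refine (abs_add_le _ _).trans ((add_le_add h1 h2).trans (le_of_eq (by ring)))
  | smul c a _ ha =>
    obtain ⟨K, hK, η, hη, h⟩ := ha (ε := ε / (|c| + 1)) (by positivity)
    refine ⟨K, hK, η, hη, fun E hE y => ?_⟩
    simp only [Pi.smul_apply, smul_eq_mul, ← Finset.mul_sum, abs_mul]
    calc |c| * |∑ e ∈ E, a (e • y)| ≤ (|c| + 1) * (ε / (|c| + 1) * E.card) := by
          gcongr
          · linarith
          · exact h E hE y
      _ = _ := by field_simp

/-- An inequality modulo coboundaries with some slack yields an inequality between sums over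
sufficiently invariant finite sets. -/
lemma AvgLE.sum_le {φ ψ : X → ℝ} {ε : ℝ} (hε : 0 < ε) (h : AvgLE Γ (fun x => φ x + ε) ψ) :
    ∃ K : Finset G, (∀ k ∈ K, k ∈ Γ) ∧ ∃ η : ℝ, 0 < η ∧ ∀ E : Finset G,
      (∀ k ∈ K, (((k • E) \ E).card : ℝ) ≤ η * E.card) →
      ∀ y : X, ∑ e ∈ E, φ (e • y) + ε / 2 * E.card ≤ ∑ e ∈ E, ψ (e • y) := by
  obtain ⟨ν, hν, hl⟩ := h
  obtain ⟨K, hK, η, hη, hE⟩ := sum_coboundary_le hν (half_pos hε)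
  refine ⟨K, hK, η, hη, fun E h y => ?_⟩
  have h1 := (abs_le.1 (hE E h y)).2
  have h2 := Finset.sum_le_sum fun e (_ : e ∈ E) => hl (e • y)
  simp only [Finset.sum_add_distrib, Finset.sum_const, nsmul_eq_mul] at h2
  linarith

end Calculus

/-! ### Castles -/

/-- The levels `s • V i`, for `s ∈ S i`, are pairwise disjoint. -/
def IsCastle {G : Type u} [Group G] {X : Type v} [MulAction G X] {ι : Type w}
    (S : ι → Finset G) (V : ι → Set X) : Prop :=
  ∀ i, ∀ s ∈ S i, ∀ j, ∀ t ∈ S j, (i, s) ≠ (j, t) → Disjoint (s • V i) (t • V j)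

/-- The union of the levels `s • V i`, for `s ∈ S i`. -/
def castleSet {G : Type u} [Group G] {X : Type v} [MulAction G X] {ι : Type w}
    (S : ι → Finset G) (V : ι → Set X) : Set X :=
  ⋃ i, ⋃ s ∈ S i, s • V i

section Castle

variable {G : Type u} [Group G] {X : Type v} [MulAction G X] {Γ : Subgroup G}
  {ι : Type w} {S S' : ι → Finset G} {V : ι → Set X}

lemma mem_castleSet {x : X} : x ∈ castleSet S V ↔ ∃ i, ∃ s ∈ S i, x ∈ s • V i := by
  simp [castleSet]

lemma smul_subset_castleSet {i : ι} {s : G} (hs : s ∈ S i) : s • V i ⊆ castleSet S V :=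
  fun _ hx => mem_castleSet.2 ⟨i, s, hs, hx⟩

lemma isOpen_castleSet [TopologicalSpace X] [ContinuousConstSMul G X] (hV : ∀ i, IsOpen (V i)) :
    IsOpen (castleSet S V) :=
  isOpen_iUnion fun i => isOpen_biUnion fun s _ => (hV i).smul s

lemma IsCastle.subset (h : IsCastle S V) (hs : ∀ i, S' i ⊆ S i) : IsCastle S' V :=
  fun i s hi j t hj hne => h i s (hs i hi) j t (hs j hj) hne

lemma IsCastle.eq_of_mem (h : IsCastle S V) {i j : ι} {s t : G} (hs : s ∈ S i) (ht : t ∈ S j)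
    {x : X} (hx : x ∈ s • V i) (hx' : x ∈ t • V j) : i = j ∧ s = t := by
  by_contra hne
  refine disjoint_left.1 (h i s hs j t ht fun he => hne ?_) hx hx'
  simpa using he

lemma ind_castleSet_le_sum [Fintype ι] (x : X) :
    ind (castleSet S V) x ≤ ∑ i, ∑ s ∈ S i, ind (s • V i) x := by
  by_cases hx : x ∈ castleSet S V
  · obtain ⟨i, s, hs, h⟩ := mem_castleSet.1 hx
    rw [ind_of_mem hx, ← ind_of_mem h]
    refine (Finset.single_le_sum (f := fun s => ind (s • V i) x) (fun k _ => ind_nonneg _ _)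
      hs).trans ?_
    exact Finset.single_le_sum (f := fun i => ∑ s ∈ S i, ind (s • V i) x)
      (fun k _ => Finset.sum_nonneg fun _ _ => ind_nonneg _ _) (Finset.mem_univ i)
  · rw [ind_of_notMem hx]
    exact Finset.sum_nonneg fun _ _ => Finset.sum_nonneg fun _ _ => ind_nonneg _ _

lemma IsCastle.sum_le_ind [Fintype ι] (h : IsCastle S V) (x : X) :
    ∑ i, ∑ s ∈ S i, ind (s • V i) x ≤ ind (castleSet S V) x := by
  rw [Finset.sum_sigma' Finset.univ S (fun i s => ind (s • V i) x)]
  refine sum_ind_le_of_pairwise_disjoint (U := fun p : (_ : ι) × G => p.2 • V p.1) ?_ ?_ x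
  · rintro ⟨i, s⟩ hs
    exact smul_subset_castleSet (by simpa using hs)
  · rintro ⟨i, s⟩ hs ⟨j, t⟩ ht hne
    refine h i s (by simpa using hs) j t (by simpa using ht) fun he => hne ?_
    simp only [Prod.mk.injEq] at he
    rw [he.1, he.2]

lemma AvgLE.sum_levels_le [Fintype ι] (hS : ∀ i, ∀ s ∈ S i, s ∈ Γ) :
    AvgLE Γ (fun x => ∑ i, ∑ s ∈ S i, ind (s • V i) x)
      (fun x => ∑ i, ((S i).card : ℝ) * ind (V i) x) := by
  refine AvgLE.sum fun i _ => ?_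
  refine (AvgLE.sum (b := fun _ => ind (V i)) fun s hs => AvgLE.ind_smul_le (hS i s hs) _).trans
    (AvgLE.of_le fun x => ?_)
  simp

lemma AvgLE.le_sum_levels [Fintype ι] (hS : ∀ i, ∀ s ∈ S i, s ∈ Γ) :
    AvgLE Γ (fun x => ∑ i, ((S i).card : ℝ) * ind (V i) x)
      (fun x => ∑ i, ∑ s ∈ S i, ind (s • V i) x) := by
  refine AvgLE.sum fun i _ => ?_
  refine (AvgLE.of_le fun x => ?_).trans
    (AvgLE.sum (a := fun _ => ind (V i)) fun s hs => AvgLE.ind_le_smul (hS i s hs) _)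
  simp

lemma AvgLE.ind_castleSet_le [Fintype ι] (hS : ∀ i, ∀ s ∈ S i, s ∈ Γ) :
    AvgLE Γ (ind (castleSet S V)) (fun x => ∑ i, ((S i).card : ℝ) * ind (V i) x) :=
  (AvgLE.of_le ind_castleSet_le_sum).trans (AvgLE.sum_levels_le hS)

lemma IsCastle.le_ind_castleSet [Fintype ι] (h : IsCastle S V) (hS : ∀ i, ∀ s ∈ S i, s ∈ Γ) :
    AvgLE Γ (fun x => ∑ i, ((S i).card : ℝ) * ind (V i) x) (ind (castleSet S V)) :=
  (AvgLE.le_sum_levels hS).trans (AvgLE.of_le h.sum_le_ind)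

/-- Modulo coboundaries all levels of a tower weigh as much as its base, so the left side is the
density of the castle. Subsets of shapes are estimated through this bound. -/
lemma IsCastle.sum_card_le_one [Fintype ι] (h : IsCastle S V) (hS : ∀ i, ∀ s ∈ S i, s ∈ Γ) :
    AvgLE Γ (fun x => ∑ i, ((S i).card : ℝ) * ind (V i) x) (fun _ => 1) :=
  (h.le_ind_castleSet hS).trans (AvgLE.of_le fun x => ind_le_one _ x)

end Castle

/-! ### Invariant sets -/

section Invariant

variable {G : Type u} [Group G]

lemma IsInvariantFor.card_smul_sdiff {K S : Finset G} {ε : ℝ} (h : IsInvariantFor K ε S) {k : G}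
    (hk : k ∈ K) : (((k • S) \ S).card : ℝ) ≤ ε * S.card := by
  refine le_trans ?_ h.le
  norm_cast
  refine Finset.card_le_card fun x hx => ?_
  rw [Finset.mem_sdiff] at hx
  refine Finset.mem_symmDiff.2 (Or.inr ⟨?_, hx.2⟩)
  obtain ⟨s, hs, rfl⟩ := Finset.mem_smul_finset.1 hx.1
  exact Finset.mul_mem_mul hk hs

lemma IsInvariantFor.nonempty {K S : Finset G} {ε : ℝ} (h : IsInvariantFor K ε S) :
    S.Nonempty := by
  by_contra hS
  rw [Finset.not_nonempty_iff_eq_empty] at hS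
  subst hS
  simp [IsInvariantFor] at h

lemma IsInvariantFor.card_mul_sdiff {K S : Finset G} {ε : ℝ} (h : IsInvariantFor K ε S) :
    (((K * S) \ S).card : ℝ) ≤ ε * S.card := by
  refine le_trans ?_ h.le
  norm_cast
  exact Finset.card_le_card fun x hx => Finset.mem_symmDiff.2 (Or.inr (Finset.mem_sdiff.1 hx))

/-- Since `S` is nonempty, `K * S` is at least as large as `K`, yet hardly larger than `S`.
Enlarging `K` thus forces large shapes. -/
lemma IsInvariantFor.card_le {K S : Finset G} {ε : ℝ} (h : IsInvariantFor K ε S) :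
    (K.card : ℝ) ≤ (1 + ε) * S.card := by
  have h1 : (K.card : ℝ) ≤ (K * S).card := by
    exact_mod_cast Finset.card_le_card_mul_right h.nonempty
  have h2 : ((K * S).card : ℝ) ≤ ((K * S) \ S).card + S.card := by
    exact_mod_cast Finset.card_le_card_sdiff_add_card
  linarith [h.card_mul_sdiff]

lemma IsInvariantFor.mono_right {K S : Finset G} {ε ε' : ℝ} (h : IsInvariantFor K ε S)
    (hε : ε ≤ ε') : IsInvariantFor K ε' S :=
  lt_of_lt_of_le h (by gcongr)

lemma isInvariantFor_of_card_mul_sdiff {K S : Finset G} (hK : K.Nonempty) {ε : ℝ}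
    (h : 2 * (((K * S) \ S).card : ℝ) < ε * S.card) : IsInvariantFor K ε S := by
  refine lt_of_le_of_lt ?_ h
  norm_cast
  obtain ⟨k, hk⟩ := hK
  have h1 : (S \ (K * S)).card ≤ ((K * S) \ S).card := by
    have hk' : k • S ⊆ K * S := fun x hx => by
      obtain ⟨s, hs, rfl⟩ := Finset.mem_smul_finset.1 hx
      exact Finset.mul_mem_mul hk hs
    have h1 := Finset.card_sdiff_add_card_inter S (K * S)
    have h2 := Finset.card_sdiff_add_card_inter (K * S) S
    rw [Finset.inter_comm] at h2
    have h3 : (k • S).card = S.card := Finset.card_smul_finset k S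
    have h4 := Finset.card_le_card hk'
    omega
  have h2 : (S ∆ (K * S)).card ≤ (S \ (K * S)).card + ((K * S) \ S).card :=
    Finset.card_union_le _ _
  omega

end Invariant

/-! ### Castles of an almost finite subgroup -/

/-- A castle with shapes in the subgroup `H` that witnesses almost finiteness of the action of `H`
for the parameters `K` and `ε`, has nonempty bases, and has shapes with at least `m` elements. -/
structure WitnessCastle {G : Type u} [Group G] (H : Subgroup G) (X : Type v) [MetricSpace X]
    [MulAction G X] (K : Finset G) (ε : ℝ) (m : ℕ) where
  ι : Type
  fintypeι : Fintype ι
  T : ι → Finset G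
  W : ι → Set X
  mem : ∀ i, ∀ t ∈ T i, t ∈ H
  isOpen : ∀ i, IsOpen (W i)
  nonempty : ∀ i, (W i).Nonempty
  castle : IsCastle T W
  diam : ∀ i, ∀ t ∈ T i, Metric.diam (t • W i) < ε
  card : ∀ i, m ≤ (T i).card
  inv : ∀ i, ∀ k ∈ K, (((k • T i) \ T i).card : ℝ) ≤ ε * (T i).card
  T' : ι → Finset G
  T'_subset : ∀ i, T' i ⊆ T i
  T'_card : ∀ i, ((T' i).card : ℝ) ≤ ε * (T i).card
  κ : Type
  fintypeκ : Fintype κ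
  U : κ → Set X
  g : κ → G
  g_mem : ∀ k, g k ∈ H
  U_open : ∀ k, IsOpen (U k)
  cover : (castleSet T W)ᶜ ⊆ ⋃ k, U k
  U_subset : ∀ k, g k • U k ⊆ castleSet T' W
  U_disj : ∀ k l, k ≠ l → Disjoint (g k • U k) (g l • U l)

attribute [instance] WitnessCastle.fintypeι WitnessCastle.fintypeκ

section Witness

variable {G : Type u} [Group G] {H : Subgroup G} {X : Type v} [MetricSpace X] [MulAction G X]

lemma IsAlmostFinite.nonempty_witnessCastle [CompactSpace X] [ContinuousConstSMul G X]
    [Infinite H] (hH : IsAlmostFinite H X) (K : Finset G)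
    (hK : ∀ k ∈ K, k ∈ H) {ε : ℝ} (hε : 0 < ε) (m : ℕ) :
    Nonempty (WitnessCastle H X K ε m) := by
  -- With tolerance at most `1`, invariance under `2 * m + 1` elements forces more than `m` elements
  -- in each shape. It also makes the invariance set nonempty when `K` is empty and `m = 0`.
  obtain ⟨K₁, hK₁⟩ : ∃ K₁ : Finset H, K₁.card = 2 * m + 1 := Infinite.exists_subset_card_eq H _
  let K₂ : Finset H := K.subtype (· ∈ H)
  obtain ⟨n, S, V, hinv, hopen, hdisj, hdiam, S', hS', hcard', hsub⟩ :=
    hH (K₁ ∪ K₂) (Finset.Nonempty.mono Finset.subset_union_left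
      (Finset.card_pos.1 (by omega))) (min ε 1) (by positivity)
  -- Empty bases are discarded, so that every level has a point and the Lebesgue number applies to
  -- it.
  let J := {i : Fin n // (V i).Nonempty}
  let emb : H ↪ G := ⟨Subtype.val, Subtype.val_injective⟩
  let T : J → Finset G := fun i => (S i.1).map emb
  let T' : J → Finset G := fun i => (S' i.1).map emb
  let W : J → Set X := fun i => V i.1
  have hset : ∀ A : Fin n → Finset H, (⋃ i, ⋃ s ∈ A i, s • V i) =
      castleSet (fun i : J => (A i.1).map emb) W := by
    intro A
    ext x
    simp only [mem_iUnion, mem_castleSet, Finset.mem_map]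
    constructor
    · rintro ⟨i, s, hs, hx⟩
      refine ⟨⟨i, ?_⟩, s.1, ⟨s, hs, rfl⟩, hx⟩
      obtain ⟨y, hy, -⟩ := hx
      exact ⟨y, hy⟩
    · rintro ⟨i, _, ⟨s, hs, rfl⟩, hx⟩
      exact ⟨i.1, s, hs, hx⟩
  rw [hset S, hset S'] at hsub
  have hclosed : IsClosed (castleSet T W)ᶜ :=
    (isOpen_castleSet (S := T) fun i => hopen i.1).isClosed_compl
  obtain ⟨p, U, g, hU, hcov, hgU, hpd⟩ := hsub _ subset_rfl hclosed.isCompact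
  refine ⟨{ ι := J, fintypeι := inferInstance, T := T, W := W, T' := T', κ := Fin p,
            fintypeκ := inferInstance, U := U, g := fun k => (g k : G)
            mem := ?_, isOpen := fun i => hopen i.1, nonempty := fun i => i.2, castle := ?_
            diam := ?_, card := ?_, inv := ?_, T'_subset := ?_, T'_card := ?_
            g_mem := fun k => (g k).2, U_open := hU, cover := hcov, U_subset := hgU
            U_disj := fun k l h => hpd h }⟩
  · intro i t ht
    obtain ⟨s, -, rfl⟩ := Finset.mem_map.1 ht
    exact s.2
  · intro i t ht j t' ht' hne
    obtain ⟨s, hs, rfl⟩ := Finset.mem_map.1 ht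
    obtain ⟨s', hs', rfl⟩ := Finset.mem_map.1 ht'
    refine hdisj i.1 s hs j.1 s' hs' fun he => hne ?_
    simp only [Prod.mk.injEq] at he ⊢
    exact ⟨Subtype.ext he.1, by rw [he.2]⟩
  · intro i t ht
    obtain ⟨s, hs, rfl⟩ := Finset.mem_map.1 ht
    exact (hdiam i.1 s hs).trans_le (min_le_left _ _)
  · intro i
    have h1 := (hinv i.1).card_le
    have h2 : K₁.card ≤ (K₁ ∪ K₂).card := Finset.card_le_card Finset.subset_union_left
    have h3 : ((K₁ ∪ K₂).card : ℝ) ≤ 2 * (S i.1).card :=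
      h1.trans (by gcongr; linarith [min_le_right ε 1])
    have h4 : (K₁ ∪ K₂).card ≤ 2 * (S i.1).card := by exact_mod_cast h3
    simp only [T, Finset.card_map]
    omega
  · intro i k hk
    have h1 := (hinv i.1).card_smul_sdiff (k := ⟨k, hK k hk⟩)
      (Finset.mem_union_right _ (by simpa [K₂] using hk))
    have h2 : (k • T i) \ T i = (((⟨k, hK k hk⟩ : H) • S i.1) \ S i.1).map emb := by
      ext x
      simp only [T, Finset.mem_sdiff, Finset.mem_map, Finset.mem_smul_finset]
      constructor
      · rintro ⟨⟨_, ⟨s, hs, rfl⟩, rfl⟩, hn⟩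
        exact ⟨⟨k, hK k hk⟩ * s, ⟨⟨s, hs, rfl⟩, fun h => hn ⟨_, h, rfl⟩⟩, rfl⟩
      · rintro ⟨_, ⟨⟨s, hs, rfl⟩, hn⟩, rfl⟩
        refine ⟨⟨s, ⟨s, hs, rfl⟩, rfl⟩, ?_⟩
        rintro ⟨a, ha, he⟩
        exact hn (emb.injective he ▸ ha)
    rw [h2, Finset.card_map]
    simp only [T, Finset.card_map]
    refine le_trans (le_of_eq ?_) (h1.trans
      (mul_le_mul_of_nonneg_right (min_le_left _ _) (Nat.cast_nonneg _)))
    congr!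
  · intro i
    exact Finset.map_subset_map.2 (hS' i.1)
  · intro i
    simp only [T, T', Finset.card_map]
    exact (hcard' i.1).le.trans (by gcongr; exact min_le_left _ _)

/-- The open neighbourhood of the remainder that is moved into the castle has small density. -/
lemma WitnessCastle.ind_iUnion_U_le {K : Finset G} {ε : ℝ} (hε : 0 ≤ ε) {m : ℕ}
    (C : WitnessCastle H X K ε m) : AvgLE H (ind (⋃ k, C.U k)) (fun _ => ε) := by
  refine (AvgLE.of_le fun x => ind_le_sum_of_mem subset_rfl x).trans ?_
  refine (AvgLE.sum fun k _ => AvgLE.ind_le_smul (C.g_mem k) (C.U k)).trans ?_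
  refine (AvgLE.of_le fun x => sum_ind_le_of_pairwise_disjoint (fun k _ => C.U_subset k)
    (fun k _ l _ h => C.U_disj k l h) x).trans ?_
  refine (AvgLE.ind_castleSet_le fun i s hs => C.mem i s (C.T'_subset i hs)).trans ?_
  refine (AvgLE.of_le (ψ := fun x => ε * ∑ i, ((C.T i).card : ℝ) * ind (C.W i) x)
    fun x => ?_).trans ?_
  · rw [Finset.mul_sum]
    refine Finset.sum_le_sum fun i _ => ?_
    rw [← mul_assoc]
    exact mul_le_mul_of_nonneg_right (C.T'_card i) (ind_nonneg _ _)
  · simpa using (C.castle.sum_card_le_one C.mem).const_mul hε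

lemma WitnessCastle.ind_compl_le {K : Finset G} {ε : ℝ} (hε : 0 ≤ ε) {m : ℕ}
    (C : WitnessCastle H X K ε m) : AvgLE H (ind (castleSet C.T C.W)ᶜ) (fun _ => ε) :=
  (AvgLE.of_le fun x => ind_mono C.cover x).trans (C.ind_iUnion_U_le hε)

end Witness

/-! ### Comparison from counting along a finite set -/

/-- A finite set can be coloured by a finite nonempty set of colours with all colour classes of
almost equal size. -/
lemma exists_balanced_coloring {α : Type u} {β : Type v} (T : Finset α) {F : Finset β}
    (hF : F.Nonempty) :
    ∃ c : α → β, (∀ t, c t ∈ F) ∧ ∀ f ∈ F,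
      ((T.filter fun t => c t = f).card : ℝ) ≤ (T.card : ℝ) / F.card + 1 ∧
      (T.card : ℝ) / F.card - 1 ≤ ((T.filter fun t => c t = f).card : ℝ) := by
  have hq : 0 < F.card := Finset.card_pos.2 hF
  obtain ⟨f₀, hf₀⟩ := hF
  let e := T.equivFin
  let d := F.equivFin
  -- Number the elements of `T` and colour by residues modulo `F.card`; the value `f₀` off `T` is
  -- arbitrary.
  let c : α → β := fun t => if h : t ∈ T then
    (d.symm ⟨(e ⟨t, h⟩ : ℕ) % F.card, Nat.mod_lt _ hq⟩ : F) else f₀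
  refine ⟨c, fun t => ?_, fun f hf => ?_⟩
  · by_cases h : t ∈ T
    · simp only [c, h, dite_true]; exact (d.symm _).2
    · simpa only [c, h, dite_false] using hf₀
  · have hcard : (T.filter fun t => c t = f).card =
        ((Finset.range T.card).filter fun i => i ≡ (d ⟨f, hf⟩ : ℕ) [MOD F.card]).card := by
      refine Finset.card_bij (fun t ht => (e ⟨t, (Finset.mem_filter.1 ht).1⟩ : ℕ)) ?_ ?_ ?_
      · intro t ht
        obtain ⟨htT, hc⟩ := Finset.mem_filter.1 ht
        simp only [c, htT, dite_true] at hc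
        have h2 : d.symm ⟨(e ⟨t, htT⟩ : ℕ) % F.card, Nat.mod_lt _ hq⟩ = ⟨f, hf⟩ :=
          Subtype.ext hc
        rw [Equiv.symm_apply_eq] at h2
        refine Finset.mem_filter.2 ⟨Finset.mem_range.2 (e ⟨t, htT⟩).2, ?_⟩
        rw [← h2]
        exact (Nat.mod_modEq _ _).symm
      · intro t ht t' ht' h
        have := e.injective (Fin.ext h)
        simpa using this
      · intro i hi
        obtain ⟨hi, hm⟩ := Finset.mem_filter.1 hi
        rw [Finset.mem_range] at hi
        have hT : (e.symm ⟨i, hi⟩ : α) ∈ T := (e.symm ⟨i, hi⟩).2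
        have h1 : (⟨i % F.card, Nat.mod_lt _ hq⟩ : Fin F.card) = d ⟨f, hf⟩ := by
          apply Fin.ext
          have : i % F.card = (d ⟨f, hf⟩ : ℕ) % F.card := hm
          simpa [Nat.mod_eq_of_lt (d ⟨f, hf⟩).2] using this
        refine ⟨e.symm ⟨i, hi⟩, Finset.mem_filter.2 ⟨hT, ?_⟩, by simp⟩
        simp only [c, hT, dite_true, Subtype.coe_eta, Equiv.apply_symm_apply, h1,
          Equiv.symm_apply_apply]
    rw [hcard, ← Nat.count_eq_card_filter_range, Nat.count_modEq_card _ hq]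
    have h1 : ((T.card / F.card : ℕ) : ℝ) ≤ (T.card : ℝ) / F.card := Nat.cast_div_le
    have h2 : (T.card : ℝ) / F.card < ((T.card / F.card : ℕ) : ℝ) + 1 := by
      rw [div_lt_iff₀ (by exact_mod_cast hq)]
      have : T.card < (T.card / F.card + 1) * F.card := by
        rw [add_mul, one_mul]; exact Nat.lt_div_mul_add hq
      exact_mod_cast this
    push_cast
    split_ifs <;> constructor <;> norm_num <;> linarith

/-! ### Uniform estimates from compactness -/

section Metric

variable {G : Type u} [Group G] {X : Type v} [MetricSpace X] [CompactSpace X] [MulAction G X]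
  [ContinuousConstSMul G X]

/-- A common Lebesgue number for the translates of an open cover. -/
lemma exists_lebesgue_number_smul {κ : Type w} {c : κ → Set X} (hc : ∀ k, IsOpen (c k))
    (hcov : ∀ x, ∃ k, x ∈ c k) (F : Finset G) :
    ∃ δ > 0, ∀ f ∈ F, ∀ Z : Set X, Z.Nonempty → Metric.diam Z < δ → ∃ k, f • Z ⊆ c k := by
  have key : ∀ f ∈ F, ∀ᶠ δ in nhdsWithin (0 : ℝ) (Ioi 0), ∀ Z : Set X, Z.Nonempty →
      Metric.diam Z < δ → ∃ k, f • Z ⊆ c k := by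
    intro f _
    obtain ⟨δ, hδ, h⟩ := lebesgue_number_lemma_of_metric (s := (univ : Set X)) isCompact_univ
      (c := fun k => (fun x => f • x) ⁻¹' c k) (fun k => (hc k).preimage (continuous_const_smul f))
      (fun x _ => by
        obtain ⟨k, hk⟩ := hcov (f • x)
        exact mem_iUnion.2 ⟨k, hk⟩)
    filter_upwards [Ioo_mem_nhdsGT hδ] with r hr Z ⟨z, hz⟩ hZ
    obtain ⟨k, hk⟩ := h z (mem_univ z)
    refine ⟨k, ?_⟩
    rintro _ ⟨y, hy, rfl⟩
    refine hk ?_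
    rw [Metric.mem_ball]
    exact (Metric.dist_le_diam_of_mem (Metric.isBounded_of_compactSpace) hy hz).trans_lt
      (hZ.trans hr.2)
  obtain ⟨δ, h, hδ⟩ := (((Filter.eventually_all_finset F).2 key).and self_mem_nhdsWithin).exists
  exact ⟨δ, hδ, h⟩

/-- A strict inequality between visit numbers survives a slight enlargement of the closed set and
a slight shrinking of the open set. -/
lemma exists_thickening_count_lt {A B : Set X} (hA : IsClosed A) (hB : IsOpen B) {F : Finset G}
    (h : ∀ x : X, (F.filter fun f => f • x ∈ A).card < (F.filter fun f => f • x ∈ B).card) :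
    ∃ δ > 0, ∀ x : X, (F.filter fun f => f • x ∈ Metric.thickening δ A).card <
      (F.filter fun f => Metric.ball (f • x) δ ⊆ B).card := by
  -- Radius `2 * r` leaves room for two errors of at most `r`: from `x` to a nearby `y`, and from
  -- thickening by `δ`.
  have key : ∀ x : X, ∃ r > 0, ∀ f : G, f ∈ F →
      (f • x ∉ A → Disjoint (Metric.ball (f • x) (2 * r)) A) ∧
      (f • x ∈ B → Metric.ball (f • x) (2 * r) ⊆ B) := by
    intro x
    have : ∀ f ∈ F, ∀ᶠ r in nhdsWithin (0 : ℝ) (Ioi 0),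
        (f • x ∉ A → Disjoint (Metric.ball (f • x) (2 * r)) A) ∧
        (f • x ∈ B → Metric.ball (f • x) (2 * r) ⊆ B) := by
      intro f _
      refine Filter.Eventually.and ?_ ?_
      · by_cases hx : f • x ∈ A
        · exact Filter.Eventually.of_forall fun r hr => absurd hx hr
        · obtain ⟨ε, hε, hb⟩ := Metric.isOpen_iff.1 hA.isOpen_compl _ hx
          filter_upwards [Ioo_mem_nhdsGT (half_pos hε)] with r hr _
          refine disjoint_left.2 fun y hy => hb (Metric.ball_subset_ball ?_ hy)
          linarith [hr.2]
      · by_cases hx : f • x ∈ B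
        · obtain ⟨ε, hε, hb⟩ := Metric.isOpen_iff.1 hB _ hx
          filter_upwards [Ioo_mem_nhdsGT (half_pos hε)] with r hr _
          refine (Metric.ball_subset_ball ?_).trans hb
          linarith [hr.2]
        · exact Filter.Eventually.of_forall fun r hr => absurd hr hx
    obtain ⟨r, h, hr⟩ := (((Filter.eventually_all_finset F).2 this).and self_mem_nhdsWithin).exists
    exact ⟨r, hr, h⟩
  choose r hr hrF using key
  let N : X → Set X := fun x => ⋂ f ∈ F, (fun y => f • y) ⁻¹' Metric.ball (f • x) (r x)
  have hNo : ∀ x, IsOpen (N x) := fun x =>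
    isOpen_biInter_finset fun f _ => Metric.isOpen_ball.preimage (continuous_const_smul f)
  have hNx : ∀ x, x ∈ N x := fun x => mem_iInter₂.2 fun f _ => Metric.mem_ball_self (hr x)
  obtain ⟨t, ht⟩ := isCompact_univ.elim_finite_subcover N hNo
    (fun x _ => mem_iUnion.2 ⟨x, hNx x⟩)
  obtain ⟨δ, hδt, hδ⟩ : ∃ δ : ℝ, (∀ x ∈ t, δ ≤ r x) ∧ 0 < δ := by
    have : ∀ x ∈ t, ∀ᶠ δ in nhdsWithin (0 : ℝ) (Ioi 0), δ ≤ r x := fun x _ => by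
      filter_upwards [Ioo_mem_nhdsGT (hr x)] with d hd using hd.2.le
    exact (((Filter.eventually_all_finset t).2 this).and self_mem_nhdsWithin).exists
  refine ⟨δ, hδ, fun y => ?_⟩
  obtain ⟨x, hxt, hy⟩ := mem_iUnion₂.1 (ht (mem_univ y))
  have hy' : ∀ f ∈ F, dist (f • y) (f • x) < r x := fun f hf => mem_iInter₂.1 hy f hf
  refine lt_of_le_of_lt (Finset.card_le_card ?_) (lt_of_lt_of_le (h x) (Finset.card_le_card ?_))
  · intro f hf
    obtain ⟨hf, hfy⟩ := Finset.mem_filter.1 hf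
    refine Finset.mem_filter.2 ⟨hf, ?_⟩
    by_contra hfx
    obtain ⟨a, ha, hd⟩ := Metric.mem_thickening_iff.1 hfy
    refine disjoint_left.1 ((hrF x f hf).1 hfx) ?_ ha
    rw [Metric.mem_ball]
    have := dist_triangle_left a (f • x) (f • y)
    linarith [hδt x hxt, hy' f hf]
  · intro f hf
    obtain ⟨hf, hfx⟩ := Finset.mem_filter.1 hf
    refine Finset.mem_filter.2 ⟨hf, fun z hz => (hrF x f hf).2 hfx ?_⟩
    rw [Metric.mem_ball] at hz ⊢
    have := dist_triangle z (f • y) (f • x)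
    linarith [hδt x hxt, hy' f hf]

end Metric

/-! ### Densities of thinned castles -/

section Colored

variable {G : Type u} [Group G] {H : Subgroup G} {X : Type v} [MetricSpace X] [MulAction G X]
  {K : Finset G} {ε : ℝ} {m : ℕ}

/-- Every tower has at least `m` levels. This absorbs the rounding error of one level per tower in
balanced colourings. -/
lemma WitnessCastle.sum_ind_base_le (C : WitnessCastle H X K ε m) (hm : 0 < m) :
    AvgLE H (fun x => ∑ i, ind (C.W i) x) (fun _ => 1 / (m : ℝ)) := by
  have hm' : (0 : ℝ) < m := by exact_mod_cast hm
  refine (AvgLE.of_le (ψ := fun x => 1 / (m : ℝ) * ∑ i, ((C.T i).card : ℝ) * ind (C.W i) x)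
    fun x => ?_).trans ?_
  · rw [Finset.mul_sum]
    refine Finset.sum_le_sum fun i _ => ?_
    rw [← mul_assoc]
    refine le_mul_of_one_le_left (ind_nonneg _ _) ?_
    rw [one_div_mul_eq_div, one_le_div hm']
    exact_mod_cast C.card i
  · simpa using (C.castle.sum_card_le_one C.mem).const_mul (c := 1 / (m : ℝ)) (by positivity)

/-- If every shape of a castle is thinned out by a factor of at most `q`, up to one element, then
the union of the levels becomes sparser by a factor of at most `q`. -/
lemma WitnessCastle.ind_castleSet_le_of_card_le (C : WitnessCastle H X K ε m) (hm : 0 < m)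
    {S S' : C.ι → Finset G} (hS : ∀ i, S i ⊆ C.T i) (hS' : ∀ i, S' i ⊆ C.T i) {q : ℝ} (hq : 0 < q)
    (h : ∀ i, ((S' i).card : ℝ) ≤ (S i).card / q + 1) :
    AvgLE H (ind (castleSet S' C.W)) (fun x => 1 / q * ind (castleSet S C.W) x + 1 / m) := by
  refine (AvgLE.ind_castleSet_le fun i s hs => C.mem i s (hS' i hs)).trans ?_
  refine (AvgLE.of_le (ψ := fun x => 1 / q * (∑ i, ((S i).card : ℝ) * ind (C.W i) x) +
    ∑ i, ind (C.W i) x) fun x => ?_).trans ?_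
  · rw [Finset.mul_sum, ← Finset.sum_add_distrib]
    refine Finset.sum_le_sum fun i _ => ?_
    calc _ ≤ ((S i).card / q + 1) * ind (C.W i) x :=
          mul_le_mul_of_nonneg_right (h i) (ind_nonneg _ _)
      _ = _ := by ring
  · exact (((C.castle.subset hS).le_ind_castleSet fun i s hs =>
      C.mem i s (hS i hs)).const_mul (by positivity)).add (C.sum_ind_base_le hm)

lemma WitnessCastle.le_ind_castleSet_of_le_card (C : WitnessCastle H X K ε m) (hm : 0 < m)
    {S S' : C.ι → Finset G} (hS : ∀ i, S i ⊆ C.T i) (hS' : ∀ i, S' i ⊆ C.T i) {q : ℝ} (hq : 0 < q)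
    (h : ∀ i, ((S i).card : ℝ) / q - 1 ≤ (S' i).card) :
    AvgLE H (fun x => 1 / q * ind (castleSet S C.W) x)
      (fun x => ind (castleSet S' C.W) x + 1 / m) := by
  refine ((AvgLE.ind_castleSet_le fun i s hs => C.mem i s (hS i hs)).const_mul
    (by positivity)).trans ?_
  refine (AvgLE.of_le (ψ := fun x => (∑ i, ((S' i).card : ℝ) * ind (C.W i) x) +
    ∑ i, ind (C.W i) x) fun x => ?_).trans ?_
  · rw [Finset.mul_sum, ← Finset.sum_add_distrib]
    refine Finset.sum_le_sum fun i _ => ?_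
    calc _ = ((S i).card / q) * ind (C.W i) x := by ring
      _ ≤ ((S' i).card + 1) * ind (C.W i) x :=
          mul_le_mul_of_nonneg_right (by linarith [h i]) (ind_nonneg _ _)
      _ = _ := by ring
  · exact ((C.castle.subset hS').le_ind_castleSet fun i s hs =>
      C.mem i s (hS' i hs)).add (C.sum_ind_base_le hm)

end Colored

/-! ### Moving sets through slots -/

section Transport

variable {G : Type u} [Group G] {X : Type v} [TopologicalSpace X] [MulAction G X]

/-- Dynamical subequivalence from a cover of `A` whose members are moved into slots, several
members of the cover possibly sharing a slot, and from a way to move the slots into `B`. -/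
lemma dynSubequiv_of_slots {κ : Type w} [Fintype κ] {P : Type*} {A B : Set X} (O : κ → Set X)
    (a : κ → G) (σ : κ → P) (W : P → Set X) (e : P → G) (hO : ∀ k, IsOpen (O k))
    (hA : A ⊆ ⋃ k, O k) (haO : ∀ k, a k • O k ⊆ W (σ k))
    (hdisj : ∀ k l, k ≠ l → σ k = σ l → Disjoint (a k • O k) (a l • O l))
    (hB : ∀ k, e (σ k) • W (σ k) ⊆ B)
    (hslots : ∀ k l, σ k ≠ σ l → Disjoint (e (σ k) • W (σ k)) (e (σ l) • W (σ l))) :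
    DynSubequiv G A B := by
  intro C hC _
  let E := (Fintype.equivFin κ).symm
  have hsub : ∀ k, (e (σ k) * a k) • O k ⊆ e (σ k) • W (σ k) := fun k => by
    rw [mul_smul]; exact smul_set_mono (haO k)
  refine ⟨Fintype.card κ, fun i => O (E i), fun i => e (σ (E i)) * a (E i), fun i => hO _, ?_,
    fun i => (hsub _).trans (hB _), ?_⟩
  · intro x hx
    obtain ⟨k, hk⟩ := mem_iUnion.1 (hA (hC hx))
    exact mem_iUnion.2 ⟨E.symm k, by simpa using hk⟩
  · intro i j hij
    have hne : E i ≠ E j := fun h => hij (E.injective h)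
    by_cases hσ : σ (E i) = σ (E j)
    · have := hdisj _ _ hne hσ
      rw [mul_smul, mul_smul, hσ]
      exact disjoint_smul_set.2 this
    · exact (hslots _ _ hσ).mono (hsub _) (hsub _)

end Transport

section Comparison

variable {G : Type u} [Group G] {H : Subgroup G} {X : Type v} [MetricSpace X] [CompactSpace X]
  [MulAction G X] [ContinuousConstSMul G X]

/-- For a normal subgroup `H` acting almost finitely: a closed set that is visited less often than
an open set along a finite set `F` can be moved into the open set. -/
theorem dynSubequiv_of_count_lt [H.Normal] [Infinite H] (hH : IsAlmostFinite H X) {A B : Set X}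
    (hA : IsClosed A) (hB : IsOpen B) {F : Finset G}
    (h : ∀ x : X, (F.filter fun f => f • x ∈ A).card < (F.filter fun f => f • x ∈ B).card) :
    DynSubequiv G A B := by
  rcases isEmpty_or_nonempty X with hX | ⟨⟨x₀⟩⟩
  · exact fun C _ _ => ⟨0, fun _ => ∅, fun _ => 1, fun i => i.elim0, fun x => hX.elim x,
      fun i => i.elim0, fun i => i.elim0⟩
  have hFne : F.Nonempty := by
    obtain ⟨f, hf⟩ := Finset.card_pos.1 (lt_of_le_of_lt (Nat.zero_le _) (h x₀))
    exact ⟨f, (Finset.mem_filter.1 hf).1⟩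
  obtain ⟨δ, hδ, hcount⟩ := exists_thickening_count_lt hA hB h
  have hq' : 0 < F.card := Finset.card_pos.2 hFne
  obtain ⟨q, hqdef⟩ : ∃ q : ℝ, q = F.card := ⟨_, rfl⟩
  have hq1 : 1 ≤ q := by rw [hqdef]; exact_mod_cast hq'
  have hq : 0 < q := by linarith
  -- The strict count leaves a gap of `1 / q` after division by `q`. The errors in `hmain` add up to
  -- `5 * q * η + η ≤ 6 / (8 * q)`, so a slack of `1 / (8 * q)` remains.
  obtain ⟨η, hηdef⟩ : ∃ η : ℝ, η = 1 / (8 * q ^ 2) := ⟨_, rfl⟩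
  have hη : 0 < η := by rw [hηdef]; positivity
  have hqη : q * η = 1 / (8 * q) := by rw [hηdef]; field_simp
  have hηq : η ≤ 1 / (8 * q) := by rw [← hqη]; nlinarith
  obtain ⟨C⟩ := hH.nonempty_witnessCastle (∅ : Finset G) (by simp) (ε := min δ η)
    (lt_min hδ hη) (8 * F.card ^ 2)
  have hm : 0 < 8 * F.card ^ 2 := by positivity
  have hmη : 1 / ((8 * F.card ^ 2 : ℕ) : ℝ) = η := by push_cast; rw [hηdef, hqdef]
  set Rp : Set X := ⋃ k, C.U k with hRp
  have hRpη : AvgLE H (ind Rp) (fun _ => η) :=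
    (C.ind_iUnion_U_le (lt_min hδ hη).le).trans (AvgLE.of_le fun _ => min_le_right _ _)
  -- the coloured levels
  let lA : C.ι → Finset G := fun i => (C.T i).filter fun t => ((t • C.W i) ∩ A).Nonempty
  let lB : C.ι → Finset G := fun i => (C.T i).filter fun t => t • C.W i ⊆ B
  have hlA : ∀ i, lA i ⊆ C.T i := fun i => Finset.filter_subset _ _
  have hlB : ∀ i, lB i ⊆ C.T i := fun i => Finset.filter_subset _ _
  -- A level of colour `f` is used only in its translate by `f⁻¹`. Each point of a level meeting `A`
  -- is thus counted for one `f`, and targets in `B` with different `f` are automatically disjoint.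
  choose cA hcAF hcA using fun i => exists_balanced_coloring (lA i) hFne
  choose cB hcBF hcB using fun i => exists_balanced_coloring (lB i) hFne
  let tA : G → C.ι → Finset G := fun f i => (lA i).filter fun t => cA i t = f
  let tB : G → C.ι → Finset G := fun f i => (lB i).filter fun t => cB i t = f
  have htA : ∀ f i, tA f i ⊆ C.T i := fun f i => (Finset.filter_subset _ _).trans (hlA i)
  have htB : ∀ f i, tB f i ⊆ C.T i := fun f i => (Finset.filter_subset _ _).trans (hlB i)
  have hthick : castleSet lA C.W ⊆ Metric.thickening δ A := by
    intro x hx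
    obtain ⟨i, t, ht, hx⟩ := mem_castleSet.1 hx
    obtain ⟨htT, a, hat, haA⟩ := Finset.mem_filter.1 ht
    refine Metric.mem_thickening_iff.2 ⟨a, haA, ?_⟩
    exact (Metric.dist_le_diam_of_mem Metric.isBounded_of_compactSpace hx hat).trans_lt
      ((C.diam i t htT).trans_le (min_le_left _ _))
  have hshrink : {y | Metric.ball y δ ⊆ B} ⊆ castleSet lB C.W ∪ Rp := by
    intro y hy
    by_cases hyC : y ∈ castleSet C.T C.W
    · obtain ⟨i, t, ht, hyt⟩ := mem_castleSet.1 hyC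
      refine Or.inl (mem_castleSet.2 ⟨i, t, Finset.mem_filter.2 ⟨ht, fun z hz => hy ?_⟩, hyt⟩)
      rw [Metric.mem_ball]
      exact (Metric.dist_le_diam_of_mem Metric.isBounded_of_compactSpace hz hyt).trans_lt
        ((C.diam i t ht).trans_le (min_le_left _ _))
    · exact Or.inr (C.cover hyC)
  have hE1 : ∀ f ∈ F, AvgLE H (ind (castleSet (tA f) C.W))
      (fun x => 1 / q * ind (Metric.thickening δ A) x + η) := by
    intro f hf
    refine (C.ind_castleSet_le_of_card_le hm hlA (htA f) hq fun i => ?_).trans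
      (AvgLE.of_le fun x => ?_)
    · rw [hqdef]; exact (hcA i f hf).1
    · rw [hmη]
      have := ind_mono hthick x
      gcongr
  have hE3 : ∀ f ∈ F, AvgLE H (fun x => 1 / q * ind {y | Metric.ball y δ ⊆ B} x)
      (fun x => ind (castleSet (tB f) C.W) x + η + 1 / q * η) := by
    intro f hf
    refine AvgLE.trans (AvgLE.of_le (ψ := fun x => 1 / q * ind (castleSet lB C.W) x +
      1 / q * ind Rp x) fun x => ?_) ?_
    · rw [← mul_add]
      refine mul_le_mul_of_nonneg_left ?_ (by positivity)
      by_cases hx : x ∈ {y | Metric.ball y δ ⊆ B}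
      · rw [ind_of_mem hx]
        rcases hshrink hx with h | h
        · rw [ind_of_mem h]; linarith [ind_nonneg Rp x]
        · rw [ind_of_mem h]; linarith [ind_nonneg (castleSet lB C.W) x]
      · rw [ind_of_notMem hx]; exact add_nonneg (ind_nonneg _ _) (ind_nonneg _ _)
    · refine AvgLE.add ?_ (hRpη.const_mul (by positivity))
      refine (C.le_ind_castleSet_of_le_card hm hlB (htB f) hq fun i => ?_).trans
        (AvgLE.of_le fun x => by rw [hmη])
      rw [hqdef]; exact (hcB i f hf).2
  -- One copy of `Rp` pays for sources inside `Rp`, the other for targets lost to `Rp`; the term `q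
  -- * η` pays for the slots reserved for the remainder of the second castle.
  have hmain : AvgLE H (fun x => (∑ f ∈ F, (ind (castleSet (tA f) C.W) (f • x) +
      2 * ind Rp (f • x)) + q * η) + 1 / (8 * q))
      (fun x => ∑ f ∈ F, ind (castleSet (tB f) C.W) (f • x)) := by
    obtain ⟨ν₁, hν₁, h₁⟩ := AvgLE.sum fun f hf => ((hE1 f hf).add
      (hRpη.const_mul (c := 2) (by norm_num))).comp_smul f
    obtain ⟨ν₂, hν₂, h₂⟩ := AvgLE.sum fun f hf => (hE3 f hf).comp_smul f
    refine ⟨ν₁ + ν₂, Submodule.add_mem _ hν₁ hν₂, fun x => ?_⟩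
    have h₁ := h₁ x
    have h₂ := h₂ x
    have h₃ : ∑ f ∈ F, ind (Metric.thickening δ A) (f • x) + 1 ≤
        ∑ f ∈ F, ind {y | Metric.ball y δ ⊆ B} (f • x) := by
      simp only [ind, Finset.sum_boole, mem_ofPred_eq]
      exact_mod_cast hcount x
    simp only [Finset.sum_add_distrib, ← Finset.mul_sum, Finset.sum_const, nsmul_eq_mul,
      ← hqdef] at h₁ h₂ ⊢
    have h₄ := mul_le_mul_of_nonneg_left h₃ (show 0 ≤ 1 / q by positivity)
    rw [mul_add, mul_one] at h₄
    have h₅ : q * (1 / q * η) = η := by field_simp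
    have h₆ : 1 / q = 8 * (1 / (8 * q)) := by field_simp
    simp only [Pi.add_apply]
    linarith
  obtain ⟨K, hK, ζ, hζ, hsum⟩ := hmain.sum_le (by positivity)
  let cov : Option ((i : C.ι) × {t // t ∈ C.T i}) → Set X := fun k =>
    k.elim Rp fun p => (p.2 : G) • C.W p.1
  obtain ⟨lam, hlam, hleb⟩ := exists_lebesgue_number_smul (c := cov)
    (by
      rintro (_ | ⟨i, t⟩)
      · exact isOpen_iUnion C.U_open
      · exact (C.isOpen i).smul _)
    (by
      intro x
      by_cases hx : x ∈ castleSet C.T C.W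
      · obtain ⟨i, t, ht, hx⟩ := mem_castleSet.1 hx
        exact ⟨some ⟨i, t, ht⟩, hx⟩
      · exact ⟨none, C.cover hx⟩) F
  -- The bound `lam` puts each `F`-translate of a level of `D` inside `Rp` or inside one level of
  -- `C`; `ζ` makes the shapes invariant enough for `hsum`; `η` bounds the proportion of `D.T'`.
  obtain ⟨D⟩ := hH.nonempty_witnessCastle K hK (ε := min lam (min ζ η))
    (lt_min hlam (lt_min hζ hη)) 0
  have hlabel : ∀ f ∈ F, ∀ i, ∀ s ∈ D.T i, f • s • D.W i ⊆ Rp ∨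
      ∃ j, ∃ t ∈ C.T j, f • s • D.W i ⊆ t • C.W j := by
    intro f hf i s hs
    obtain ⟨k, hk⟩ := hleb f hf (s • D.W i) ((D.nonempty i).smul_set)
      ((D.diam i s hs).trans_le (min_le_left _ _))
    rcases k with _ | ⟨j, t, ht⟩
    · exact Or.inl hk
    · exact Or.inr ⟨j, t, ht, hk⟩
  -- A pair `(f, s)` stands for the set `f • s • D.W i`. `src₁` lists the sets that may meet `A` in
  -- colour `f` or in `Rp`, and `src₂` the slots, one family for each `f`, that receive the
  -- remainder of `D`.
  let src₁ : D.ι → Finset (G × G) := fun i => (F ×ˢ D.T i).filter fun p =>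
    p.1 • p.2 • D.W i ⊆ Rp ∨ ∃ j, ∃ t ∈ tA p.1 j, p.1 • p.2 • D.W i ⊆ t • C.W j
  let src₂ : D.ι → Finset (G × G) := fun i => F ×ˢ D.T' i
  let tgt : D.ι → Finset (G × G) := fun i => (F ×ˢ D.T i).filter fun p =>
    ∃ j, ∃ t ∈ tB p.1 j, p.1 • p.2 • D.W i ⊆ t • C.W j
  have hcard : ∀ i, ((src₁ i).disjSum (src₂ i)).card ≤ (tgt i).card := by
    intro i
    obtain ⟨v, hv⟩ := D.nonempty i
    have hmem : ∀ f s : G, f • s • v ∈ f • s • D.W i := fun f s =>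
      smul_mem_smul_set (smul_mem_smul_set hv)
    have h1 := hsum (D.T i) (fun k hk => (D.inv i k hk).trans
      (by gcongr; exact (min_le_right _ _).trans (min_le_left _ _))) v
    have hs1 : ((src₁ i).card : ℝ) ≤ ∑ s ∈ D.T i, ∑ f ∈ F,
        (ind (castleSet (tA f) C.W) (f • s • v) + ind Rp (f • s • v)) := by
      rw [Finset.sum_comm, ← Finset.sum_product']
      simp only [src₁, Finset.card_filter]
      push_cast
      refine Finset.sum_le_sum fun p _ => ?_
      split_ifs with hp
      · rcases hp with hp | ⟨j, t, ht, hp⟩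
        · rw [ind_of_mem (hp (hmem _ _))]
          linarith [ind_nonneg (castleSet (tA p.1) C.W) (p.1 • p.2 • v)]
        · rw [ind_of_mem (mem_castleSet.2 ⟨j, t, ht, hp (hmem _ _)⟩)]
          linarith [ind_nonneg Rp (p.1 • p.2 • v)]
      · exact add_nonneg (ind_nonneg _ _) (ind_nonneg _ _)
    have hs2 : ((src₂ i).card : ℝ) ≤ q * η * (D.T i).card := by
      simp only [src₂, Finset.card_product]
      push_cast
      rw [← hqdef, mul_assoc]
      refine mul_le_mul_of_nonneg_left ((D.T'_card i).trans ?_) hq.le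
      gcongr
      exact (min_le_right _ _).trans (min_le_right _ _)
    have hs3 : ∑ s ∈ D.T i, ∑ f ∈ F, ind (castleSet (tB f) C.W) (f • s • v) ≤
        (tgt i).card + ∑ s ∈ D.T i, ∑ f ∈ F, ind Rp (f • s • v) := by
      rw [Finset.sum_comm, ← Finset.sum_product', Finset.sum_comm, ← Finset.sum_product']
      simp only [tgt, Finset.card_filter]
      push_cast
      rw [← Finset.sum_add_distrib]
      refine Finset.sum_le_sum fun p hp => ?_
      obtain ⟨hpF, hpT⟩ := Finset.mem_product.1 hp
      by_cases hb : p.1 • p.2 • v ∈ castleSet (tB p.1) C.W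
      · rcases hlabel p.1 hpF i p.2 hpT with hR | ⟨j, t, ht, hsub⟩
        · rw [ind_of_mem (hR (hmem _ _))]
          have := ind_le_one (castleSet (tB p.1) C.W) (p.1 • p.2 • v)
          split_ifs <;> linarith
        · obtain ⟨j', t', ht', hm'⟩ := mem_castleSet.1 hb
          obtain ⟨rfl, rfl⟩ := C.castle.eq_of_mem ht (htB _ _ ht') (hsub (hmem _ _)) hm'
          rw [if_pos ⟨j, t, ht', hsub⟩, ind_of_mem hb]
          linarith [ind_nonneg Rp (p.1 • p.2 • v)]
      · rw [ind_of_notMem hb]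
        refine add_nonneg ?_ (ind_nonneg _ _)
        split_ifs <;> norm_num
    simp only [Finset.sum_add_distrib, ← Finset.mul_sum, Finset.sum_const, nsmul_eq_mul] at h1 hs1
    have h2 : 0 ≤ 1 / (8 * q) / 2 * ((D.T i).card : ℝ) := by positivity
    have h3 : ((src₁ i).card : ℝ) + (src₂ i).card ≤ (tgt i).card := by linarith
    rw [Finset.card_disjSum]
    exact_mod_cast h3
  have hinj : ∀ i, ∃ τ : (G × G) ⊕ (G × G) → G × G,
      (∀ p ∈ (src₁ i).disjSum (src₂ i), τ p ∈ tgt i) ∧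
      InjOn τ ((src₁ i).disjSum (src₂ i) : Finset _) := by
    intro i
    obtain ⟨τ, h1, h2⟩ := Set.Finite.exists_injOn_of_encard_le
      (s := (((src₁ i).disjSum (src₂ i) : Finset _) : Set ((G × G) ⊕ (G × G))))
      (t := ((tgt i : Finset _) : Set (G × G))) (Finset.finite_toSet _)
      (by simp only [Set.encard_coe_eq_coe_finsetCard]; exact_mod_cast hcard i)
    exact ⟨τ, fun p hp => h1 hp, h2⟩
  choose τ hτ hτinj using hinj
  let κ := ((i : D.ι) × {p // p ∈ src₁ i}) ⊕ (((i : D.ι) × {p // p ∈ src₂ i}) × D.κ)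
  -- The map `a` returns each piece to a base of `D`. A piece of the remainder first goes back by
  -- `f⁻¹`, then by `D.g` into a level of `D.T'`, and is cut according to that level.
  let O : κ → Set X := Sum.elim (fun z => (z.2.1.1 * z.2.1.2) • D.W z.1)
    (fun z => z.1.2.1.1 • (D.U z.2 ∩ (D.g z.2)⁻¹ • z.1.2.1.2 • D.W z.1.1))
  let a : κ → G := Sum.elim (fun z => (z.2.1.1 * z.2.1.2)⁻¹)
    (fun z => z.1.2.1.2⁻¹ * D.g z.2 * z.1.2.1.1⁻¹)
  let σ : κ → D.ι × ((G × G) ⊕ (G × G)) := Sum.elim (fun z => (z.1, Sum.inl z.2.1))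
    (fun z => (z.1.1, Sum.inr z.1.2.1))
  have hσ : ∀ k, (σ k).2 ∈ (src₁ (σ k).1).disjSum (src₂ (σ k).1) := by
    rintro (⟨i, p, hp⟩ | ⟨⟨i, p, hp⟩, k⟩)
    · exact Finset.inl_mem_disjSum.2 hp
    · exact Finset.inr_mem_disjSum.2 hp
  have haO' : ∀ (z : ((i : D.ι) × {p // p ∈ src₂ i}) × D.κ), a (Sum.inr z) • O (Sum.inr z) =
      z.1.2.1.2⁻¹ • (D.g z.2 • D.U z.2 ∩ z.1.2.1.2 • D.W z.1.1) := by
    intro z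
    simp only [a, O, Sum.elim_inr, mul_smul, inv_smul_smul, smul_set_inter, smul_inv_smul]
  refine dynSubequiv_of_slots O a σ (fun p => D.W p.1)
    (fun p => (τ p.1 p.2).1 * (τ p.1 p.2).2) ?_ ?_ ?_ ?_ ?_ ?_
  · rintro (z | z)
    · exact (D.isOpen _).smul _
    · exact ((D.U_open _).inter (((D.isOpen _).smul _).smul _)).smul _
  · intro x hx
    have hrem : ∀ f ∈ F, f⁻¹ • x ∉ castleSet D.T D.W → x ∈ ⋃ k, O k := by
      intro f hf hn
      obtain ⟨k, hk⟩ := mem_iUnion.1 (D.cover hn)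
      obtain ⟨i, s, hs, hm'⟩ := mem_castleSet.1 (D.U_subset k (smul_mem_smul_set hk))
      refine mem_iUnion.2 ⟨Sum.inr (⟨i, (f, s), Finset.mem_product.2 ⟨hf, hs⟩⟩, k), ?_⟩
      simp only [O, Sum.elim_inr]
      rw [mem_smul_set_iff_inv_smul_mem]
      exact ⟨hk, by rwa [mem_smul_set_iff_inv_smul_mem, inv_inv]⟩
    have hin : ∀ f ∈ F, ∀ i, ∀ s ∈ D.T i, f⁻¹ • x ∈ s • D.W i → (f, s) ∈ src₁ i →
        x ∈ ⋃ k, O k := by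
      intro f hf i s hs hx hsrc
      refine mem_iUnion.2 ⟨Sum.inl ⟨i, (f, s), hsrc⟩, ?_⟩
      simp only [O, Sum.elim_inl, mul_smul]
      rwa [mem_smul_set_iff_inv_smul_mem]
    -- A point in a level of `C` uses the colour of that level. Off all levels any `f` serves, since
    -- a translated level of `D` around the point must then lie in `Rp`.
    have hdich : ∃ f ∈ F, ∀ j, ∀ t ∈ C.T j, x ∈ t • C.W j → t ∈ tA f j := by
      by_cases hxC : x ∈ castleSet C.T C.W
      · obtain ⟨j, t, ht, hxt⟩ := mem_castleSet.1 hxC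
        refine ⟨cA j t, hcAF j t, fun j' t' ht' hxt' => ?_⟩
        obtain ⟨rfl, rfl⟩ := C.castle.eq_of_mem ht ht' hxt hxt'
        exact Finset.mem_filter.2 ⟨Finset.mem_filter.2 ⟨ht, x, hxt, hx⟩, rfl⟩
      · obtain ⟨f, hf⟩ := hFne
        exact ⟨f, hf, fun j t ht hxt => absurd (mem_castleSet.2 ⟨j, t, ht, hxt⟩) hxC⟩
    obtain ⟨f, hf, hfx⟩ := hdich
    by_cases hxD : f⁻¹ • x ∈ castleSet D.T D.W
    · obtain ⟨i, s, hs, hxs⟩ := mem_castleSet.1 hxD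
      refine hin f hf i s hs hxs (Finset.mem_filter.2 ⟨Finset.mem_product.2 ⟨hf, hs⟩, ?_⟩)
      rcases hlabel f hf i s hs with hR | ⟨j, t, ht, hsub⟩
      · exact Or.inl hR
      · exact Or.inr ⟨j, t, hfx j t ht (hsub (mem_smul_set_iff_inv_smul_mem.2 hxs)), hsub⟩
    · exact hrem f hf hxD
  · rintro (z | z)
    · simp only [a, O, σ, Sum.elim_inl, inv_smul_smul]; exact subset_rfl
    · rw [haO', smul_set_inter, inv_smul_smul]
      exact inter_subset_right
  · rintro (⟨i, p, hp⟩ | ⟨⟨i, p, hp⟩, k⟩) (⟨j, p', hp'⟩ | ⟨⟨j, p', hp'⟩, l⟩) hne he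
    · simp only [σ, Sum.elim_inl, Prod.mk.injEq, Sum.inl.injEq] at he
      obtain ⟨rfl, rfl⟩ := he
      exact absurd rfl hne
    · simp [σ] at he
    · simp [σ] at he
    · simp only [σ, Sum.elim_inr, Prod.mk.injEq, Sum.inr.injEq] at he
      obtain ⟨rfl, rfl⟩ := he
      have hkl : k ≠ l := fun h => hne (by rw [h])
      rw [haO', haO']
      refine disjoint_smul_set.2 ?_
      exact (D.U_disj k l hkl).mono inter_subset_left inter_subset_left
  · intro k
    obtain ⟨-, j, t, ht, hsub⟩ := Finset.mem_filter.1 (hτ _ _ (hσ k))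
    rw [mul_smul]
    exact hsub.trans (Finset.mem_filter.1 (Finset.mem_filter.1 ht).1).2
  · intro k l hne
    obtain ⟨hp, j, t, ht, hsub⟩ := Finset.mem_filter.1 (hτ _ _ (hσ k))
    obtain ⟨hp', j', t', ht', hsub'⟩ := Finset.mem_filter.1 (hτ _ _ (hσ l))
    have hne' : ((σ k).1, τ (σ k).1 (σ k).2) ≠ ((σ l).1, τ (σ l).1 (σ l).2) := by
      intro he
      simp only [Prod.mk.injEq] at he
      obtain ⟨h1, h2⟩ := he
      refine hne (Prod.ext h1 ?_)
      have hl := hσ l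
      rw [← h1] at h2 hl
      exact hτinj _ (hσ k) hl h2
    simp only [mul_smul]
    -- For equal first coordinates disjointness comes from the castle `D`; otherwise the targets lie
    -- in levels of `C` of different colours.
    by_cases hf : (τ (σ k).1 (σ k).2).1 = (τ (σ l).1 (σ l).2).1
    · rw [hf]
      refine disjoint_smul_set.2 (D.castle _ _ (Finset.mem_product.1 hp).2 _ _
        (Finset.mem_product.1 hp').2 fun he => hne' ?_)
      simp only [Prod.mk.injEq] at he
      exact Prod.ext he.1 (Prod.ext hf he.2)
    · refine (C.castle j t (htB _ _ ht) j' t' (htB _ _ ht') fun he => hf ?_).mono hsub hsub'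
      simp only [Prod.mk.injEq] at he
      obtain ⟨rfl, rfl⟩ := he
      rw [← (Finset.mem_filter.1 ht).2, ← (Finset.mem_filter.1 ht').2]

end Comparison

/-! ### Partitions with sparse remainder -/

section Partition

variable {G : Type u} [Group G] {H : Subgroup G} {X : Type v} [MetricSpace X] [CompactSpace X]
  [MulAction G X] [ContinuousConstSMul G X]

/-- For an almost finite action, a fixed number of disjoint open sets of small diameter covers the
space up to a remainder of arbitrarily small density. -/
lemma exists_disjoint_open_small [Infinite H] (hH : IsAlmostFinite H X) {η : ℝ} (hη : 0 < η) :
    ∃ N : ℕ, ∀ δ > 0, ∃ U : Fin N → Set X, (∀ j, IsOpen (U j)) ∧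
      (∀ i j, i ≠ j → Disjoint (U i) (U j)) ∧
      (∀ j, ∀ x ∈ U j, ∀ y ∈ U j, dist x y < η) ∧ AvgLE H (ind (⋃ j, U j)ᶜ) (fun _ => δ) := by
  obtain ⟨t, ht⟩ := isCompact_univ.elim_finite_subcover (fun x : X => Metric.ball x (η / 2))
    (fun x => Metric.isOpen_ball)
    (fun x _ => mem_iUnion.2 ⟨x, Metric.mem_ball_self (half_pos hη)⟩)
  obtain ⟨lam, hlam, hleb⟩ := exists_lebesgue_number_smul (G := G)
    (c := fun j : Fin t.card => Metric.ball (t.equivFin.symm j : X) (η / 2))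
    (fun j => Metric.isOpen_ball) (fun x => by
      obtain ⟨y, hy, hxy⟩ := mem_iUnion₂.1 (ht (mem_univ x))
      exact ⟨t.equivFin ⟨y, hy⟩, by simpa using hxy⟩) {1}
  -- The number of sets is that of a cover by balls, fixed before `δ`. The levels of a castle
  -- depending on `δ` are grouped by a ball containing them.
  refine ⟨t.card, fun δ hδ => ?_⟩
  obtain ⟨C⟩ := hH.nonempty_witnessCastle (∅ : Finset G) (by simp) (ε := min lam δ)
    (lt_min hlam hδ) 0
  have hlab : ∀ i, ∀ s ∈ C.T i, ∃ j : Fin t.card,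
      s • C.W i ⊆ Metric.ball (t.equivFin.symm j : X) (η / 2) := by
    intro i s hs
    simpa using hleb 1 (by simp) (s • C.W i) ((C.nonempty i).smul_set)
      ((C.diam i s hs).trans_le (min_le_left _ _))
  choose lab hlab using hlab
  refine ⟨fun j => castleSet (fun i => (C.T i).filter fun s => ∃ hs, lab i s hs = j) C.W,
    fun j => isOpen_castleSet C.isOpen, fun j j' hne => ?_, fun j x hx y hy => ?_, ?_⟩
  · refine disjoint_left.2 fun x hx hx' => hne ?_
    obtain ⟨i, s, hs, hx⟩ := mem_castleSet.1 hx
    obtain ⟨i', s', hs', hx'⟩ := mem_castleSet.1 hx'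
    rw [Finset.mem_filter] at hs hs'
    obtain ⟨rfl, rfl⟩ := C.castle.eq_of_mem hs.1 hs'.1 hx hx'
    obtain ⟨⟨-, ⟨_, h⟩⟩, ⟨-, ⟨_, h'⟩⟩⟩ := And.intro hs hs'
    exact h.symm.trans h'
  · have key : ∀ z ∈ castleSet (fun i => (C.T i).filter fun s => ∃ hs, lab i s hs = j) C.W,
        dist z (t.equivFin.symm j : X) < η / 2 := by
      intro z hz
      obtain ⟨i, s, hs, hzs⟩ := mem_castleSet.1 hz
      obtain ⟨-, hsT, rfl⟩ := Finset.mem_filter.1 hs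
      exact hlab i s hsT hzs
    have := dist_triangle_right x y (t.equivFin.symm j : X)
    linarith [key x hx, key y hy]
  · refine AvgLE.trans (AvgLE.of_le fun x => ind_mono (compl_subset_compl.2 ?_) x)
      ((C.ind_compl_le (lt_min hlam hδ).le).trans (AvgLE.of_le fun _ => min_le_right _ _))
    intro x hx
    obtain ⟨i, s, hs, hx⟩ := mem_castleSet.1 hx
    exact mem_iUnion.2 ⟨lab i s hs,
      mem_castleSet.2 ⟨i, s, Finset.mem_filter.2 ⟨hs, hs, rfl⟩, hx⟩⟩

end Partition

/-! ### Quasitilings -/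

/-- The set `V` is locally constant at all points outside of `Q`. -/
def LocConstOff {X : Type v} [TopologicalSpace X] (Q V : Set X) : Prop :=
  ∀ x ∉ Q, ∀ᶠ y in nhds x, (y ∈ V ↔ x ∈ V)

lemma LocConstOff.mono {X : Type v} [TopologicalSpace X] {Q Q' V : Set X} (h : LocConstOff Q V)
    (hQ : Q ⊆ Q') : LocConstOff Q' V :=
  fun x hx => h x fun hx' => hx (hQ hx')

/-- The subsets of `F` that contain at least a proportion `1 - ε` of its elements. -/
noncomputable def largeSubsets {α : Type u} (ε : ℝ) (F : Finset α) : Finset (Finset α) :=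
  F.powerset.filter fun S => (1 - ε) * F.card ≤ (S.card : ℝ)

/-- A castle whose shapes `S i` arise from tiles `F i` by removing a proportion of at most `ε`,
the full tiles over the bases being covered by the castle. -/
structure QuasiTiling (G : Type u) [Group G] (X : Type v) [MulAction G X] (ε : ℝ) where
  ι : Type u
  fintypeι : Fintype ι
  S : ι → Finset G
  F : ι → Finset G
  V : ι → Set X
  S_subset : ∀ i, S i ⊆ F i
  S_card : ∀ i, (1 - ε) * (F i).card ≤ (S i).card
  castle : IsCastle S V
  full : ∀ i, ∀ f ∈ F i, f • V i ⊆ castleSet S V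

attribute [instance] QuasiTiling.fintypeι

namespace QuasiTiling

variable {G : Type u} [Group G] {X : Type v} [MulAction G X] {ε : ℝ}

/-- The part of the space covered by a quasitiling. -/
def covered (𝒬 : QuasiTiling G X ε) : Set X := castleSet 𝒬.S 𝒬.V

/-- The quasitiling without tiles. -/
def empty (G : Type u) [Group G] (X : Type v) [MulAction G X] (ε : ℝ) : QuasiTiling G X ε where
  ι := PEmpty
  fintypeι := inferInstance
  S := fun i => i.elim
  F := fun i => i.elim
  V := fun i => i.elim
  S_subset := fun i => i.elim
  S_card := fun i => i.elim
  castle := fun i => i.elim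
  full := fun i => i.elim

/-- The base of the tower of shape `S` in a greedy extension by tiles `F • c` with `c ∈ U`. -/
def extendBase (𝒬 : QuasiTiling G X ε) (F : Finset G) (U : Set X) (S : Finset G) : Set X :=
  {c | c ∈ U ∧ ∀ f ∈ F, (f ∈ S ↔ f • c ∉ 𝒬.covered)}

/-- The greedy extension of a quasitiling by tiles `F • c`, for those `c ∈ U` for which at most
a proportion `ε` of the tile is covered already. -/
noncomputable def extend (𝒬 : QuasiTiling G X ε) (F : Finset G) (U : Set X)
    (hU : ∀ f ∈ F, ∀ f' ∈ F, f ≠ f' → Disjoint (f • U) (f' • U)) : QuasiTiling G X ε where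
  ι := 𝒬.ι ⊕ {S : Finset G // S ∈ largeSubsets ε F}
  fintypeι := inferInstance
  S := Sum.elim 𝒬.S fun S => S.1
  F := Sum.elim 𝒬.F fun _ => F
  V := Sum.elim 𝒬.V fun S => 𝒬.extendBase F U S.1
  S_subset := by
    rintro (i | ⟨S, hS⟩)
    · exact 𝒬.S_subset i
    · exact Finset.mem_powerset.1 (Finset.mem_filter.1 hS).1
  S_card := by
    rintro (i | ⟨S, hS⟩)
    · exact 𝒬.S_card i
    · exact (Finset.mem_filter.1 hS).2
  castle := by
    have hmix : ∀ i, ∀ s ∈ 𝒬.S i, ∀ S ⊆ F, ∀ t ∈ S,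
        Disjoint (s • 𝒬.V i) (t • 𝒬.extendBase F U S) := by
      intro i s hs S hS t ht
      refine disjoint_left.2 fun x hx hx' => ?_
      obtain ⟨c, hc, rfl⟩ := hx'
      exact (hc.2 t (hS ht)).1 ht (smul_subset_castleSet hs hx)
    rintro (i | ⟨S, hS⟩) s hs (j | ⟨S', hS'⟩) t ht hne
    · exact 𝒬.castle i s hs j t ht fun he => hne (by simpa using he)
    · exact hmix i s hs S' (Finset.mem_powerset.1 (Finset.mem_filter.1 hS').1) t ht
    · exact (hmix j t ht S (Finset.mem_powerset.1 (Finset.mem_filter.1 hS).1) s hs).symm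
    · have hSF := Finset.mem_powerset.1 (Finset.mem_filter.1 hS).1
      have hSF' := Finset.mem_powerset.1 (Finset.mem_filter.1 hS').1
      -- On a common level, `S` is determined by the centre as the uncovered part of its tile; on
      -- different levels, the separation of `U` applies.
      by_cases hst : s = t
      · subst hst
        refine disjoint_smul_set.2 (disjoint_left.2 fun c hc hc' => hne ?_)
        have : S = S' := by
          ext f
          constructor
          · exact fun hf => (hc'.2 f (hSF hf)).2 ((hc.2 f (hSF hf)).1 hf)
          · exact fun hf => (hc.2 f (hSF' hf)).2 ((hc'.2 f (hSF' hf)).1 hf)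
        subst this
        rfl
      · exact (hU s (hSF hs) t (hSF' ht) hst).mono (smul_set_mono fun c hc => hc.1)
          (smul_set_mono fun c hc => hc.1)
  full := by
    have hold : 𝒬.covered ⊆ castleSet (Sum.elim 𝒬.S fun S :
        {S : Finset G // S ∈ largeSubsets ε F} => S.1)
        (Sum.elim 𝒬.V fun S => 𝒬.extendBase F U S.1) := by
      intro x hx
      obtain ⟨i, s, hs, hx⟩ := mem_castleSet.1 hx
      exact mem_castleSet.2 ⟨Sum.inl i, s, hs, hx⟩
    rintro (i | ⟨S, hS⟩) f hf
    · exact (𝒬.full i f hf).trans hold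
    · rintro _ ⟨c, hc, rfl⟩
      by_cases hfS : f ∈ S
      · exact mem_castleSet.2 ⟨Sum.inr ⟨S, hS⟩, f, hfS, smul_mem_smul_set hc⟩
      · refine hold ?_
        by_contra hn
        exact hfS ((hc.2 f hf).2 hn)

variable {F : Finset G} {U : Set X}
  {hU : ∀ f ∈ F, ∀ f' ∈ F, f ≠ f' → Disjoint (f • U) (f' • U)}

lemma covered_subset_extend (𝒬 : QuasiTiling G X ε) :
    𝒬.covered ⊆ (𝒬.extend F U hU).covered := by
  intro x hx
  obtain ⟨i, s, hs, hx⟩ := mem_castleSet.1 hx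
  exact mem_castleSet.2 ⟨Sum.inl i, s, hs, hx⟩

lemma mem_covered_extend {𝒬 : QuasiTiling G X ε} {x : X} :
    x ∈ (𝒬.extend F U hU).covered ↔ x ∈ 𝒬.covered ∨
      ∃ S ∈ largeSubsets ε F, ∃ s ∈ S,
        s⁻¹ • x ∈ 𝒬.extendBase F U S := by
  constructor
  · intro hx
    obtain ⟨i | ⟨S, hS⟩, s, hs, hx⟩ := mem_castleSet.1 hx
    · exact Or.inl (mem_castleSet.2 ⟨i, s, hs, hx⟩)
    · exact Or.inr ⟨S, hS, s, hs, mem_smul_set_iff_inv_smul_mem.1 hx⟩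
  · rintro (hx | ⟨S, hS, s, hs, hx⟩)
    · exact covered_subset_extend _ hx
    · exact mem_castleSet.2 ⟨Sum.inr ⟨S, hS⟩, s, hs, mem_smul_set_iff_inv_smul_mem.2 hx⟩

/-- Either the uncovered part of the tile at `c` is large enough to be added, and then the whole
tile gets covered, or more than a proportion `ε` was covered before. -/
lemma le_card_covered_extend (𝒬 : QuasiTiling G X ε) (hε : ε ≤ 1) {c : X} (hc : c ∈ U) :
    ε * F.card ≤ (F.filter fun f => f • c ∈ (𝒬.extend F U hU).covered).card := by
  let S := F.filter fun f => f • c ∉ 𝒬.covered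
  have hSF : S ⊆ F := Finset.filter_subset _ _
  by_cases hS : (1 - ε) * F.card ≤ S.card
  · have hmem : S ∈ largeSubsets ε F :=
      Finset.mem_filter.2 ⟨Finset.mem_powerset.2 hSF, hS⟩
    have hcS : c ∈ 𝒬.extendBase F U S := ⟨hc, fun f hf => by simp [S, hf]⟩
    have hall : ∀ f ∈ F, f • c ∈ (𝒬.extend F U hU).covered := fun f hf =>
      (𝒬.extend F U hU).full (Sum.inr ⟨S, hmem⟩) f hf (smul_mem_smul_set hcS)
    rw [Finset.filter_true_of_mem hall]
    exact mul_le_of_le_one_left (Nat.cast_nonneg _) hε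
  · have h1 : ((F.filter fun f => f • c ∈ 𝒬.covered).card : ℝ) + S.card = F.card := by
      exact_mod_cast Finset.card_filter_add_card_filter_not (s := F) fun f => f • c ∈ 𝒬.covered
    have h2 : ((F.filter fun f => f • c ∈ 𝒬.covered).card : ℝ) ≤
        (F.filter fun f => f • c ∈ (𝒬.extend F U hU).covered).card := by
      exact_mod_cast Finset.card_le_card
        (Finset.monotone_filter_right _ fun f _ hf => covered_subset_extend 𝒬 hf)
    push Not at hS
    linarith

/-- The points outside of the covered set that `F` moves into it are sparse if the tiles are
sufficiently invariant. -/
lemma ind_boundary_le (𝒬 : QuasiTiling G X ε) (hε : ε ≤ 1 / 2) {η : ℝ} (hη : 0 ≤ η)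
    (hinv : ∀ i, (((F⁻¹ * 𝒬.F i) \ 𝒬.F i).card : ℝ) ≤ η * (𝒬.F i).card) :
    AvgLE (⊤ : Subgroup G) (ind {c | c ∉ 𝒬.covered ∧ ∃ f ∈ F, f • c ∈ 𝒬.covered})
      (fun _ => 2 * η) := by
  have hsub : {c | c ∉ 𝒬.covered ∧ ∃ f ∈ F, f • c ∈ 𝒬.covered} ⊆
      castleSet (fun i => (F⁻¹ * 𝒬.F i) \ 𝒬.F i) 𝒬.V := by
    rintro c ⟨hc, f, hf, hfc⟩
    obtain ⟨i, s, hs, hx⟩ := mem_castleSet.1 hfc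
    have hx' : c ∈ (f⁻¹ * s) • 𝒬.V i := by
      rw [mul_smul, mem_smul_set_iff_inv_smul_mem, inv_inv]; exact hx
    refine mem_castleSet.2 ⟨i, f⁻¹ * s, Finset.mem_sdiff.2
      ⟨Finset.mul_mem_mul (Finset.inv_mem_inv hf) (𝒬.S_subset i hs), fun hn => ?_⟩, hx'⟩
    exact hc (𝒬.full i _ hn hx')
  refine (AvgLE.of_le fun x => ind_mono hsub x).trans
    ((AvgLE.ind_castleSet_le fun _ _ _ => Subgroup.mem_top _).trans ?_)
  -- The factor `2` passes from full tiles to shapes, which contain at least half of them.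
  refine (AvgLE.of_le (ψ := fun x => 2 * η * ∑ i, ((𝒬.S i).card : ℝ) * ind (𝒬.V i) x)
    fun x => ?_).trans ?_
  · rw [Finset.mul_sum]
    refine Finset.sum_le_sum fun i _ => ?_
    rw [← mul_assoc]
    refine mul_le_mul_of_nonneg_right ((hinv i).trans ?_) (ind_nonneg _ _)
    have h1 := 𝒬.S_card i
    have h2 : (0 : ℝ) ≤ (𝒬.F i).card := Nat.cast_nonneg _
    have h3 : ((𝒬.F i).card : ℝ) ≤ 2 * (𝒬.S i).card := by nlinarith
    nlinarith
  · simpa using (𝒬.castle.sum_card_le_one fun _ _ _ => Subgroup.mem_top _).const_mul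
      (c := 2 * η) (by positivity)

/-- If every point off a sparse set `R` has a proportion `ε` of its `F`-tile covered, then the
uncovered part has shrunk by a factor of almost `1 - ε`. -/
lemma uncovered_le (𝒬 𝒬' : QuasiTiling G X ε) (hε0 : 0 ≤ ε) (hε : ε ≤ 1 / 2) {η δ : ℝ}
    (hη : 0 ≤ η) (hF : F.Nonempty)
    (hinv : ∀ i, (((F⁻¹ * 𝒬.F i) \ 𝒬.F i).card : ℝ) ≤ η * (𝒬.F i).card)
    (hsub : 𝒬.covered ⊆ 𝒬'.covered) {R : Set X}
    (hR : AvgLE (⊤ : Subgroup G) (ind R) (fun _ => δ))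
    (hcov : ∀ c ∉ R, ε * F.card ≤ (F.filter fun f => f • c ∈ 𝒬'.covered).card) :
    AvgLE (⊤ : Subgroup G) (fun x => (1 - ind 𝒬'.covered x) - (2 * η + δ))
      (fun x => (1 - ε) * ((1 - ind 𝒬.covered x) - (2 * η + δ))) := by
  set D : Set X := {c | c ∉ 𝒬.covered ∧ ∃ f ∈ F, f • c ∈ 𝒬.covered} with hD
  have hq : (0 : ℝ) < F.card := by exact_mod_cast Finset.card_pos.2 hF
  -- Off the covered set, `D` and `R`, the whole `F`-tile was uncovered and at least a proportion
  -- `ε` of it is now covered. Averaging over `F` changes the gain only by a coboundary.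
  have h1 : AvgLE (⊤ : Subgroup G) (fun x => ε * (1 - ind 𝒬.covered x - ind D x - ind R x))
      (fun x => ind 𝒬'.covered x - ind 𝒬.covered x) := by
    refine (AvgLE.of_le (ψ := fun x => 1 / (F.card : ℝ) *
      ∑ f ∈ F, (ind 𝒬'.covered (f • x) - ind 𝒬.covered (f • x))) fun x => ?_).trans ?_
    · have hnn : 0 ≤ 1 / (F.card : ℝ) *
          ∑ f ∈ F, (ind 𝒬'.covered (f • x) - ind 𝒬.covered (f • x)) :=
        mul_nonneg (by positivity) (Finset.sum_nonneg fun f _ => sub_nonneg.2 (ind_mono hsub _))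
      have hY := ind_nonneg 𝒬.covered x
      have hDn := ind_nonneg D x
      have hRn := ind_nonneg R x
      by_cases hxY : x ∈ 𝒬.covered
      · rw [ind_of_mem hxY]; nlinarith
      by_cases hxD : x ∈ D
      · rw [ind_of_mem hxD]; nlinarith
      by_cases hxR : x ∈ R
      · rw [ind_of_mem hxR]; nlinarith
      have hnot : ∀ f ∈ F, f • x ∉ 𝒬.covered := fun f hf h => hxD ⟨hxY, f, hf, h⟩
      rw [ind_of_notMem hxY, ind_of_notMem hxD, ind_of_notMem hxR, one_div_mul_eq_div,
        le_div_iff₀ hq]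
      have : ∑ f ∈ F, (ind 𝒬'.covered (f • x) - ind 𝒬.covered (f • x)) =
          (F.filter fun f => f • x ∈ 𝒬'.covered).card := by
        rw [← Finset.sum_boole]
        refine Finset.sum_congr rfl fun f hf => ?_
        rw [ind_of_notMem (hnot f hf), sub_zero, ind]
      rw [this]
      simpa using hcov x hxR
    · refine ((AvgLE.sum fun f _ => AvgLE.smul_le (Γ := (⊤ : Subgroup G))
        (φ := fun x => ind 𝒬'.covered x - ind 𝒬.covered x) (k := f) (Subgroup.mem_top f) (C := 2)
        fun x => ?_).const_mul (by positivity)).trans (AvgLE.of_le fun x => ?_)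
      · have := ind_nonneg 𝒬.covered x
        have := ind_nonneg 𝒬'.covered x
        have := ind_le_one 𝒬.covered x
        have := ind_le_one 𝒬'.covered x
        rw [abs_le]; constructor <;> linarith
      · rw [Finset.sum_const, nsmul_eq_mul, ← mul_assoc, one_div_mul_cancel hq.ne', one_mul]
  -- The uncovered part `u` becomes at most `(1 - ε) * u + ε * (2 * η + δ)`. Subtracting the fixed
  -- point `2 * η + δ` makes the recursion linear and ready for iteration.
  obtain ⟨ν₁, hν₁, l₁⟩ := h1
  obtain ⟨ν₂, hν₂, l₂⟩ := (𝒬.ind_boundary_le hε hη hinv).const_mul hε0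
  obtain ⟨ν₃, hν₃, l₃⟩ := hR.const_mul hε0
  refine ⟨ν₁ + ν₂ + ν₃, Submodule.add_mem _ (Submodule.add_mem _ hν₁ hν₂) hν₃, fun x => ?_⟩
  have l₁ := l₁ x
  have l₂ := l₂ x
  have l₃ := l₃ x
  simp only [Pi.add_apply]
  linarith

/-- Membership of `c` is decided by `U` at `c` and by the covered set at the points `f • c`, so it
can jump only on `Q` and its translates by `f⁻¹`. -/
lemma locConstOff_extendBase [TopologicalSpace X] [ContinuousConstSMul G X]
    {𝒬 : QuasiTiling G X ε} {Q : Set X} {L : Set G} (hL : 1 ∈ L) (hFL : ∀ f ∈ F, f⁻¹ ∈ L)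
    (hUQ : LocConstOff Q U) (hQ : LocConstOff Q 𝒬.covered) (S : Finset G) :
    LocConstOff (L • Q) (𝒬.extendBase F U S) := by
  intro x hx
  have h1 := hUQ x fun h => hx ⟨1, hL, x, h, one_smul _ _⟩
  have h2 : ∀ f ∈ F, ∀ᶠ y in nhds x, (f • y ∈ 𝒬.covered ↔ f • x ∈ 𝒬.covered) := fun f hf =>
    (continuous_const_smul f).continuousAt.eventually
      (hQ (f • x) fun h => hx ⟨f⁻¹, hFL f hf, f • x, h, inv_smul_smul _ _⟩)
  filter_upwards [h1, (Filter.eventually_all_finset F).2 h2] with y hy1 hy2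
  refine and_congr hy1 (forall₂_congr fun f hf => ?_)
  rw [hy2 f hf]

/-- Passing from bases to levels costs a second factor `L`, so one extension enlarges the
exceptional set by `L * L`. -/
lemma locConstOff_covered_extend [TopologicalSpace X] [ContinuousConstSMul G X]
    {𝒬 : QuasiTiling G X ε} {Q : Set X} {L : Set G} (hL : 1 ∈ L) (hFL : ∀ f ∈ F, f ∈ L)
    (hFL' : ∀ f ∈ F, f⁻¹ ∈ L) (hUQ : LocConstOff Q U) (hQ : LocConstOff Q 𝒬.covered) :
    LocConstOff (L • L • Q) (𝒬.extend F U hU).covered := by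
  intro x hx
  have h1 := hQ x fun h => hx ⟨1, hL, x, ⟨1, hL, x, h, one_smul _ _⟩, one_smul _ _⟩
  have h2 : ∀ S ∈ largeSubsets ε F, ∀ s ∈ S,
      ∀ᶠ y in nhds x, (s⁻¹ • y ∈ 𝒬.extendBase F U S ↔ s⁻¹ • x ∈ 𝒬.extendBase F U S) := by
    intro S hS s hs
    have hsF := Finset.mem_powerset.1 (Finset.mem_filter.1 hS).1 hs
    exact (continuous_const_smul s⁻¹).continuousAt.eventually
      (locConstOff_extendBase hL hFL' hUQ hQ S (s⁻¹ • x) fun h =>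
        hx ⟨s, hFL s hsF, s⁻¹ • x, h, smul_inv_smul _ _⟩)
  filter_upwards [h1, (Filter.eventually_all_finset _).2 fun S hS =>
    (Filter.eventually_all_finset _).2 (h2 S hS)] with y hy1 hy2
  rw [mem_covered_extend, mem_covered_extend, hy1]
  refine or_congr Iff.rfl (exists_congr fun S => and_congr_right fun hS =>
    exists_congr fun s => and_congr_right fun hs => hy2 S hS s hs)

/-- The bases lie in members of the family `U`, and all sets in the quasitiling are locally
constant off `Q`. -/
structure IsAdapted [TopologicalSpace X] (𝒬 : QuasiTiling G X ε) {J : Type w} (U : J → Set X)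
    (Q : Set X) : Prop where
  base : ∀ i, ∃ j, 𝒬.V i ⊆ U j
  locV : ∀ i, LocConstOff Q (𝒬.V i)
  loc : LocConstOff Q 𝒬.covered

section Scale

variable [TopologicalSpace X] [ContinuousConstSMul G X] {J : Type w} {U : J → Set X} {Q : Set X}
  {L : Set G}

lemma IsAdapted.extend {𝒬 : QuasiTiling G X ε} (h : 𝒬.IsAdapted U Q) (hL : 1 ∈ L)
    (hFL : ∀ f ∈ F, f ∈ L) (hFL' : ∀ f ∈ F, f⁻¹ ∈ L) (j : J)
    (hU : ∀ f ∈ F, ∀ f' ∈ F, f ≠ f' → Disjoint (f • U j) (f' • U j))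
    (hUQ : LocConstOff Q (U j)) : (𝒬.extend F (U j) hU).IsAdapted U ((L * L) • Q) := by
  have hLL : L • L • Q = (L * L) • Q := by rw [smul_smul]
  have hL1 : ∀ Q : Set X, Q ⊆ L • Q := fun Q x hx => ⟨1, hL, x, hx, one_smul _ _⟩
  constructor
  · rintro (i | S)
    · exact h.base i
    · exact ⟨j, fun c hc => hc.1⟩
  · rw [← hLL]
    rintro (i | S)
    · exact (h.locV i).mono ((hL1 Q).trans (hL1 _))
    · exact (locConstOff_extendBase hL hFL' hUQ h.loc S.1).mono (hL1 _)
  · rw [← hLL]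
    exact locConstOff_covered_extend hL hFL hFL' hUQ h.loc

/-- Greedy extension over all colours `U j` with `j` in a finite set. -/
lemma exists_extend_finset {R : Set X} (hL : 1 ∈ L) (hFL : ∀ f ∈ F, f ∈ L)
    (hFL' : ∀ f ∈ F, f⁻¹ ∈ L) (hε : ε ≤ 1)
    (hU : ∀ j, ∀ f ∈ F, ∀ f' ∈ F, f ≠ f' → Disjoint (f • U j) (f' • U j))
    (hUR : ∀ j, LocConstOff R (U j)) (𝒬 : QuasiTiling G X ε) {k : ℕ}
    (h : 𝒬.IsAdapted U (((L * L) ^ k : Set G) • R)) (s : Finset J) :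
    ∃ 𝒬' : QuasiTiling G X ε, 𝒬'.IsAdapted U (((L * L) ^ (k + s.card) : Set G) • R) ∧
      𝒬.covered ⊆ 𝒬'.covered ∧ (∀ i, 𝒬'.F i = F ∨ ∃ i', 𝒬'.F i = 𝒬.F i') ∧
      ∀ j ∈ s, ∀ c ∈ U j, ε * F.card ≤ (F.filter fun f => f • c ∈ 𝒬'.covered).card := by
  induction s using Finset.induction_on with
  | empty => exact ⟨𝒬, by simpa using h, subset_rfl, fun i => Or.inr ⟨i, rfl⟩, by simp⟩
  | insert j s hj ih =>
    obtain ⟨𝒬', h1, h2, h3, h4⟩ := ih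
    have hmono : R ⊆ ((L * L) ^ (k + s.card) : Set G) • R := fun x hx =>
      ⟨1, Set.one_mem_pow (Set.mem_mul.2 ⟨1, hL, 1, hL, one_mul 1⟩), x, hx, one_smul _ _⟩
    refine ⟨𝒬'.extend F (U j) (hU j), ?_, h2.trans (covered_subset_extend _), ?_, ?_⟩
    · have := h1.extend hL hFL hFL' j (hU j) ((hUR j).mono hmono)
      rwa [smul_smul, ← pow_succ', add_assoc, ← Finset.card_insert_of_notMem hj] at this
    · rintro (i | S)
      · exact h3 i
      · exact Or.inl rfl
    · intro j' hj' c hc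
      rcases Finset.mem_insert.1 hj' with rfl | hj'
      · exact le_card_covered_extend 𝒬' hε hc
      · refine (h4 j' hj' c hc).trans ?_
        exact_mod_cast Finset.card_le_card
          (Finset.monotone_filter_right _ fun f _ hf => covered_subset_extend 𝒬' hf)

/-- Greedy extension over several scales. -/
lemma exists_extend_list [Fintype J] (hL : 1 ∈ L) (hε0 : 0 ≤ ε) (hε : ε ≤ 1 / 2) {η δ : ℝ}
    (hη : 0 ≤ η) (hUR : ∀ j, LocConstOff (⋃ j, U j)ᶜ (U j))
    (hR : AvgLE (⊤ : Subgroup G) (ind (⋃ j, U j)ᶜ) (fun _ => δ)) (P : Finset G → Prop)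
    (l : List (Finset G)) (hne : ∀ F ∈ l, F.Nonempty) (hP : ∀ F ∈ l, P F)
    (hl : l.Pairwise fun F' F => (((F⁻¹ * F') \ F').card : ℝ) ≤ η * F'.card)
    (hlL : ∀ F ∈ l, ∀ f ∈ F, f ∈ L ∧ f⁻¹ ∈ L)
    (hU : ∀ j, ∀ F ∈ l, ∀ f ∈ F, ∀ f' ∈ F, f ≠ f' → Disjoint (f • U j) (f' • U j)) :
    ∀ (𝒬 : QuasiTiling G X ε) (k : ℕ),
      𝒬.IsAdapted U (((L * L) ^ k : Set G) • (⋃ j, U j)ᶜ) → (∀ i, P (𝒬.F i)) →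
      (∀ i, ∀ F ∈ l, (((F⁻¹ * 𝒬.F i) \ 𝒬.F i).card : ℝ) ≤ η * (𝒬.F i).card) →
      ∃ 𝒬' : QuasiTiling G X ε,
        𝒬'.IsAdapted U (((L * L) ^ (k + l.length * Fintype.card J) : Set G) • (⋃ j, U j)ᶜ) ∧
        (∀ i, P (𝒬'.F i)) ∧
        AvgLE (⊤ : Subgroup G) (fun x => (1 - ind 𝒬'.covered x) - (2 * η + δ))
          (fun x => (1 - ε) ^ l.length * ((1 - ind 𝒬.covered x) - (2 * η + δ))) := by
  induction l with
  | nil => exact fun 𝒬 k h hPQ _ => ⟨𝒬, by simpa using h, hPQ, AvgLE.of_le fun x => by simp⟩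
  | cons F l ih =>
    intro 𝒬 k h hPQ hinv
    rw [List.pairwise_cons] at hl
    simp only [List.mem_cons, forall_eq_or_imp] at hne hP hlL hinv hU
    obtain ⟨𝒬₁, h1, h2, h3, h4⟩ := exists_extend_finset hL (fun f hf => (hlL.1 f hf).1)
      (fun f hf => (hlL.1 f hf).2) (by linarith) (fun j => (hU j).1) hUR 𝒬 h
      (Finset.univ : Finset J)
    have hstep := uncovered_le 𝒬 𝒬₁ hε0 hε hη hne.1 (fun i => (hinv i).1) h2 hR
      (fun c hc => by
        rw [mem_compl_iff, not_not] at hc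
        obtain ⟨j, hj⟩ := mem_iUnion.1 hc
        exact h4 j (Finset.mem_univ j) c hj)
    obtain ⟨𝒬', h5, h6, h7⟩ := ih hne.2 hP.2 hl.2 hlL.2 (fun j => (hU j).2) 𝒬₁ _ h1
      (fun i => by
        rcases h3 i with h | ⟨i', h⟩
        · rw [h]; exact hP.1
        · rw [h]; exact hPQ i')
      (fun i F' hF' => by
        rcases h3 i with h | ⟨i', h⟩
        · rw [h]; exact hl.1 F' hF'
        · rw [h]; exact (hinv i').2 F' hF')
    refine ⟨𝒬', ?_, h6, h7.trans ((hstep.const_mul (pow_nonneg (by linarith) _)).trans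
      (AvgLE.of_le fun x => ?_))⟩
    · have : k + (F :: l).length * Fintype.card J =
          k + (Finset.univ : Finset J).card + l.length * Fintype.card J := by
        rw [List.length_cons, Finset.card_univ]; ring
      rwa [this]
    · rw [List.length_cons, pow_succ, mul_assoc]

end Scale

end QuasiTiling

/-! ### The extension theorem -/

section Folner

variable {G : Type u} [Group G]

/-- In an infinite amenable group there are arbitrarily long lists of large Følner sets, each of
which is almost invariant under the inverses of its successors. -/
lemma IsAmenableGroup.exists_folner_list [Infinite G] (hG : IsAmenableGroup G) (K : Finset G)
    {η : ℝ} (hη : 0 < η) (M n : ℕ) :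
    ∃ l : List (Finset G), l.length = n ∧
      (∀ F ∈ l, F.Nonempty ∧ (((K * F) \ F).card : ℝ) ≤ η * F.card ∧ M ≤ F.card) ∧
      l.Pairwise fun F' F => (((F⁻¹ * F') \ F').card : ℝ) ≤ η * F'.card := by
  induction n with
  | zero => exact ⟨[], rfl, by simp, List.Pairwise.nil⟩
  | succ n ih =>
    obtain ⟨l, hlen, hl, hp⟩ := ih
    obtain ⟨K₁, hK₁⟩ : ∃ K₁ : Finset G, K₁.card = 2 * M + 1 := Infinite.exists_subset_card_eq G _
    -- New sets go to the front: the tiling uses the head first, and earlier tiles must be nearly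
    -- invariant under the inverses of later ones. `K₁` forces more than `M` elements.
    let K₂ : Finset G := K ∪ K₁ ∪ l.toFinset.biUnion fun F => F⁻¹
    have hK₂ : K₁ ⊆ K₂ := Finset.subset_union_right.trans Finset.subset_union_left
    obtain ⟨F', hF'⟩ := hG K₂ ((Finset.card_pos.1 (by omega)).mono hK₂) (min η 1)
      (by positivity)
    have hsub : ∀ A : Finset G, A ⊆ K₂ → (((A * F') \ F').card : ℝ) ≤ η * F'.card := by
      intro A hA
      refine le_trans ?_ (hF'.card_mul_sdiff.trans (by gcongr; exact min_le_left _ _))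
      exact_mod_cast Finset.card_le_card
        (Finset.sdiff_subset_sdiff (Finset.mul_subset_mul_right hA) le_rfl)
    refine ⟨F' :: l, by simp [hlen], ?_, List.pairwise_cons.2 ⟨fun F hF => hsub _ ?_, hp⟩⟩
    · simp only [List.mem_cons, forall_eq_or_imp]
      refine ⟨⟨hF'.nonempty, hsub K (Finset.subset_union_left.trans Finset.subset_union_left),
        ?_⟩, hl⟩
      have h1 : ((2 * M + 1 : ℕ) : ℝ) ≤ 2 * F'.card := by
        rw [← hK₁]
        refine le_trans (by exact_mod_cast Finset.card_le_card hK₂) (hF'.card_le.trans ?_)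
        gcongr
        linarith [min_le_right η 1]
      have h2 : 2 * M + 1 ≤ 2 * F'.card := by exact_mod_cast h1
      omega
    · exact (Finset.subset_biUnion_of_mem (fun F : Finset G => F⁻¹)
        (List.mem_toFinset.2 hF)).trans Finset.subset_union_right

/-- A set obtained from a Følner set by removing a small proportion of its elements is a
Følner set. -/
lemma isInvariantFor_of_large_subset {K F S : Finset G} (hK : K.Nonempty) {ε : ℝ} (hε : 0 < ε)
    (hε1 : ε ≤ 1) (hF : F.Nonempty) (hKF : (((K * F) \ F).card : ℝ) ≤ ε / 16 * F.card)
    (hSF : S ⊆ F) (hS : (1 - ε / 16) * F.card ≤ S.card) : IsInvariantFor K ε S := by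
  refine isInvariantFor_of_card_mul_sdiff hK ?_
  have h1 : (((K * S) \ S).card : ℝ) ≤ ((K * F) \ F).card + (F \ S).card := by
    norm_cast
    refine (Finset.card_le_card ?_).trans (Finset.card_union_le _ _)
    intro x hx
    rw [Finset.mem_sdiff] at hx
    have hxF := Finset.mul_subset_mul_left hSF hx.1
    by_cases h : x ∈ F
    · exact Finset.mem_union_right _ (Finset.mem_sdiff.2 ⟨h, hx.2⟩)
    · exact Finset.mem_union_left _ (Finset.mem_sdiff.2 ⟨hxF, h⟩)
  have h2 : ((F \ S).card : ℝ) + S.card = F.card := by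
    exact_mod_cast Finset.card_sdiff_add_card_eq_card hSF
  have h3 : (0 : ℝ) < F.card := by exact_mod_cast Finset.card_pos.2 hF
  nlinarith

end Folner

/-! ### Small sets under a free action -/

section Separation

variable {G : Type u} [Group G] {X : Type v} [MetricSpace X] [CompactSpace X]
  [MulAction G X] [ContinuousConstSMul G X]

lemma exists_le_dist_smul_of_free {g : G} (hg : ∀ x : X, g • x ≠ x) :
    ∃ r > 0, ∀ x : X, r ≤ dist (g • x) x := by
  rcases isEmpty_or_nonempty X with hX | hX
  · exact ⟨1, one_pos, fun x => hX.elim x⟩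
  · obtain ⟨x₀, -, h⟩ := isCompact_univ.exists_isMinOn (univ_nonempty (α := X))
      (f := fun x : X => dist (g • x) x)
      ((continuous_const_smul g).dist continuous_id).continuousOn
    exact ⟨_, dist_pos.2 (hg x₀), fun x => h (mem_univ x)⟩

/-- For a free action, sufficiently small sets have disjoint translates of small diameter. -/
lemma exists_separation (hfree : ∀ (g : G) (x : X), g • x = x → g = 1) (L : Finset G) {ε : ℝ}
    (hε : 0 < ε) :
    ∃ η > 0, ∀ U : Set X, (∀ x ∈ U, ∀ y ∈ U, dist x y < η) →
      (∀ f ∈ L, ∀ f' ∈ L, f ≠ f' → Disjoint (f • U) (f' • U)) ∧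
      ∀ f ∈ L, ∀ V ⊆ U, Metric.diam (f • V) < ε := by
  have h1 : ∀ f ∈ L, ∀ f' ∈ L, ∀ᶠ η in nhdsWithin (0 : ℝ) (Ioi 0), f ≠ f' →
      ∀ U : Set X, (∀ x ∈ U, ∀ y ∈ U, dist x y < η) → Disjoint (f • U) (f' • U) := by
    intro f _ f' _
    by_cases hff : f = f'
    · exact Filter.Eventually.of_forall fun _ h => absurd hff h
    obtain ⟨r, hr, hr'⟩ := exists_le_dist_smul_of_free (X := X) (g := f'⁻¹ * f) fun x hx =>
      hff (inv_mul_eq_one.1 (hfree _ x hx)).symm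
    filter_upwards [Ioo_mem_nhdsGT hr] with η hη _ U hU
    refine disjoint_left.2 ?_
    rintro _ ⟨x, hx, rfl⟩ ⟨y, hy, hxy⟩
    have : y = (f'⁻¹ * f) • x := by
      rw [mul_smul, eq_inv_smul_iff]; exact hxy
    have h2 := hr' x
    rw [← this] at h2
    linarith [hU y hy x hx, hη.2]
  have h2 : ∀ f ∈ L, ∀ᶠ η in nhdsWithin (0 : ℝ) (Ioi 0), ∀ U : Set X,
      (∀ x ∈ U, ∀ y ∈ U, dist x y < η) → ∀ V ⊆ U, Metric.diam (f • V) < ε := by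
    intro f _
    obtain ⟨d, hd, hd'⟩ := Metric.uniformContinuous_iff.1
      (CompactSpace.uniformContinuous_of_continuous (continuous_const_smul (T := X) f))
      (ε / 2) (half_pos hε)
    filter_upwards [Ioo_mem_nhdsGT hd] with η hη U hU V hV
    refine (Metric.diam_le_of_forall_dist_le (half_pos hε).le ?_).trans_lt (half_lt_self hε)
    rintro _ ⟨x, hx, rfl⟩ _ ⟨y, hy, rfl⟩
    exact (hd' ((hU x (hV hx) y (hV hy)).trans hη.2)).le
  obtain ⟨η, ⟨h1, h2⟩, hη⟩ := (((Filter.eventually_all_finset L).2 fun f hf =>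
    (Filter.eventually_all_finset L).2 (h1 f hf)).and
    ((Filter.eventually_all_finset L).2 h2)).and self_mem_nhdsWithin |>.exists
  exact ⟨η, hη, fun U hU => ⟨fun f hf f' hf' hne => h1 f hf f' hf' hne U hU,
    fun f hf => h2 f hf U hU⟩⟩

end Separation

lemma locConstOff_compl_iUnion {X : Type v} [TopologicalSpace X] {J : Type w} {U : J → Set X}
    (hU : ∀ j, IsOpen (U j)) (hd : ∀ i j, i ≠ j → Disjoint (U i) (U j)) (j : J) : LocConstOff (⋃ j, U j)ᶜ (U j) := by
  intro x hx
  rw [mem_compl_iff, not_not] at hx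
  obtain ⟨i, hi⟩ := mem_iUnion.1 hx
  filter_upwards [(hU i).mem_nhds hi] with y hy
  by_cases hij : i = j
  · subst hij; exact iff_of_true hy hi
  · exact iff_of_false (fun h => disjoint_left.1 (hd i j hij) hy h)
      (fun h => disjoint_left.1 (hd i j hij) hi h)

lemma sum_ind_smul {G : Type u} [Group G] {X : Type v} [MulAction G X] (F : Finset G) (A : Set X)
    (x : X) : ∑ f ∈ F, ind A (f • x) = (F.filter fun f => f • x ∈ A).card := by
  simp only [ind, Finset.sum_boole]

lemma AvgLE.ind_finset_smul_le {G : Type u} [Group G] {X : Type v} [MulAction G X]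
    {Γ : Subgroup G} {R : Set X} {δ : ℝ} (h : AvgLE Γ (ind R) (fun _ => δ)) {P : Finset G}
    (hP : ∀ p ∈ P, p ∈ Γ) :
    AvgLE Γ (ind ((P : Set G) • R)) (fun _ => P.card * δ) := by
  refine (AvgLE.of_le (ψ := fun x => ∑ p ∈ P, ind (p • R) x) fun x => ?_).trans
    ((AvgLE.sum fun p hp => (AvgLE.ind_smul_le (hP p hp) R).trans h).trans
      (AvgLE.of_le fun x => by simp))
  by_cases hx : x ∈ (P : Set G) • R
  · obtain ⟨p, hp, y, hy, rfl⟩ := mem_smul.1 hx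
    rw [show ind ((P : Set G) • R) (p • y) = 1 from ind_of_mem (smul_mem_smul hp hy),
      ← ind_of_mem (A := p • R) (x := p • y) (smul_mem_smul_set hy)]
    exact Finset.single_le_sum (f := fun p' => ind (p' • R) (p • y))
      (fun k _ => ind_nonneg _ _) hp
  · rw [ind_of_notMem hx]; exact Finset.sum_nonneg fun _ _ => ind_nonneg _ _

section Main

variable {G : Type u} [Group G] {X : Type v} [MetricSpace X] [CompactSpace X]
  [MulAction G X] [ContinuousConstSMul G X]

set_option maxHeartbeats 1000000 in
/-- For an amenable group with an infinite almost finite subgroup: castles with prescribed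
invariance and diameter whose remainder is sparse. -/
theorem exists_castle_sparse_compl {H : Subgroup G} [Infinite H] (hG : IsAmenableGroup G)
    (hfree : ∀ (g : G) (x : X), g • x = x → g = 1) (hH : IsAlmostFinite H X) {K : Finset G}
    (hK : K.Nonempty) {ε : ℝ} (hε : 0 < ε) (hε1 : ε ≤ 1) (M : ℕ) :
    ∃ (ι : Type u) (_ : Fintype ι) (S : ι → Finset G) (V : ι → Set X),
      (∀ i, IsInvariantFor K ε (S i)) ∧ (∀ i, IsOpen (V i)) ∧ IsCastle S V ∧
      (∀ i, ∀ s ∈ S i, Metric.diam (s • V i) < ε) ∧ (∀ i, M ≤ (S i).card) ∧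
      AvgLE (⊤ : Subgroup G) (ind (castleSet S V)ᶜ) (fun _ => ε / 8) := by
  have : Infinite G := Infinite.of_injective (Subtype.val : H → G) Subtype.val_injective
  -- The final density is at most `ε / 32` from the `n` scales, `ε / 64 + ε / 64` from the shift `2
  -- * η + δ`, and `ε / 64` from `P • R`, in total below `ε / 8`.
  obtain ⟨n, hn⟩ := exists_pow_lt_of_lt_one (show 0 < ε / 32 by positivity)
    (show 1 - ε / 16 < 1 by linarith)
  obtain ⟨l, hlen, hl, hpair⟩ := hG.exists_folner_list K (η := ε / 128) (by positivity) (2 * M) n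
  let L : Finset G := insert 1 (l.toFinset.biUnion fun F => F ∪ F⁻¹)
  have hL1 : (1 : G) ∈ L := Finset.mem_insert_self _ _
  have hlL : ∀ F ∈ l, ∀ f ∈ F, f ∈ L ∧ f⁻¹ ∈ L := fun F hF f hf =>
    ⟨Finset.mem_insert_of_mem (Finset.mem_biUnion.2 ⟨F, List.mem_toFinset.2 hF,
      Finset.mem_union_left _ hf⟩), Finset.mem_insert_of_mem (Finset.mem_biUnion.2
      ⟨F, List.mem_toFinset.2 hF, Finset.mem_union_right _ (Finset.inv_mem_inv hf)⟩)⟩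
  obtain ⟨ρ, hρ, hsep⟩ := exists_separation (X := X) hfree L hε
  obtain ⟨N, hN⟩ := exists_disjoint_open_small hH hρ
  -- There are `n * N` extensions, one for each scale and colour; the extra factor passes from bases
  -- to levels. `P` is fixed before the colours, so their complement may have density `ε / 64 /
  -- P.card`.
  obtain ⟨P, hP⟩ : ∃ P : Finset G, P = (L * L) ^ (n * N + 1) := ⟨_, rfl⟩
  have hLL : (1 : G) ∈ L * L := Finset.mem_mul.2 ⟨1, hL1, 1, hL1, one_mul 1⟩
  have hP1 : (1 : G) ∈ P := hP ▸ Finset.one_mem_pow hLL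
  have hPcard : (1 : ℝ) ≤ P.card := by exact_mod_cast Finset.card_pos.2 ⟨1, hP1⟩
  obtain ⟨U, hUo, hUd, hUdist, hUR⟩ := hN (ε / 64 / P.card) (by positivity)
  have hR : AvgLE (⊤ : Subgroup G) (ind (⋃ j, U j)ᶜ) (fun _ => ε / 64 / P.card) :=
    hUR.mono le_top
  have hempty : (QuasiTiling.empty G X (ε / 16)).IsAdapted U
      (((L * L : Set G) ^ 0 : Set G) • (⋃ j, U j)ᶜ) := by
    refine ⟨fun i => i.elim, fun i => i.elim, fun x _ => Filter.Eventually.of_forall fun y => ?_⟩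
    have : ∀ z : X, z ∉ (QuasiTiling.empty G X (ε / 16)).covered := fun z hz => by
      obtain ⟨i, -⟩ := mem_castleSet.1 hz
      exact i.elim
    exact iff_of_false (this y) (this x)
  obtain ⟨𝒬, had, hPQ, hcov⟩ := QuasiTiling.exists_extend_list (U := U) (L := (L : Set G)) hL1
    (by positivity) (show ε / 16 ≤ 1 / 2 by linarith) (show 0 ≤ ε / 128 by positivity)
    (locConstOff_compl_iUnion hUo hUd) hR (fun F => F ∈ l) l (fun F hF => (hl F hF).1)
    (fun F hF => hF) hpair hlL (fun j F hF f hf f' hf' hne =>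
      (hsep (U j) (hUdist j)).1 f (hlL F hF f hf).1 f' (hlL F hF f' hf').1 hne)
    (QuasiTiling.empty G X (ε / 16)) 0 hempty (fun i => i.elim) (fun i => i.elim)
  rw [zero_add, hlen, Fintype.card_fin] at had
  have hSL : ∀ i, ∀ s ∈ 𝒬.S i, s ∈ L := fun i s hs =>
    (hlL _ (hPQ i) s (𝒬.S_subset i hs)).1
  refine ⟨𝒬.ι, 𝒬.fintypeι, 𝒬.S, fun i => interior (𝒬.V i), fun i => ?_, fun i => isOpen_interior,
    ?_, ?_, ?_, ?_⟩
  · have h := hl _ (hPQ i)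
    refine isInvariantFor_of_large_subset hK hε hε1 h.1 (h.2.1.trans ?_) (𝒬.S_subset i)
      (𝒬.S_card i)
    gcongr
    norm_num
  · exact fun i s hs j t ht hne => (𝒬.castle i s hs j t ht hne).mono
      (smul_set_mono interior_subset) (smul_set_mono interior_subset)
  · intro i s hs
    obtain ⟨j, hj⟩ := had.base i
    exact (hsep (U j) (hUdist j)).2 s (hSL i s hs) _ (interior_subset.trans hj)
  · intro i
    have h1 : ((2 * M : ℕ) : ℝ) ≤ (𝒬.F i).card := by exact_mod_cast (hl _ (hPQ i)).2.2
    have h2 := 𝒬.S_card i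
    push_cast at h1
    have h3 : (M : ℝ) ≤ (𝒬.S i).card := by nlinarith
    exact_mod_cast h3
  -- A covered point lost to the interiors lies over a base point where the base is not locally
  -- constant, hence in `P • R`.
  · have hsub : (castleSet 𝒬.S fun i => interior (𝒬.V i))ᶜ ⊆
        𝒬.coveredᶜ ∪ (P : Set G) • (⋃ j, U j)ᶜ := by
      intro x hx
      by_cases hxc : x ∈ 𝒬.covered
      · right
        obtain ⟨i, s, hs, hxs⟩ := mem_castleSet.1 hxc
        rw [mem_smul_set_iff_inv_smul_mem] at hxs
        by_cases hq : s⁻¹ • x ∈ ((L * L : Set G) ^ (n * N) : Set G) • (⋃ j, U j)ᶜ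
        · have : s • s⁻¹ • x ∈ (L * L : Set G) • ((L * L : Set G) ^ (n * N) : Set G) •
              (⋃ j, U j)ᶜ :=
            smul_mem_smul (Set.mem_mul.2 ⟨s, hSL i s hs, 1, hL1, mul_one s⟩) hq
          rw [smul_inv_smul, smul_smul, ← pow_succ'] at this
          simpa [hP] using this
        · refine absurd (mem_castleSet.2 ⟨i, s, hs, ?_⟩) hx
          rw [mem_smul_set_iff_inv_smul_mem, mem_interior_iff_mem_nhds]
          filter_upwards [had.locV i _ hq] with y hy using hy.2 hxs
      · exact Or.inl hxc
    have h1 := hR.ind_finset_smul_le (P := P) fun _ _ => Subgroup.mem_top _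
    obtain ⟨ν₁, hν₁, l₁⟩ := h1
    obtain ⟨ν₂, hν₂, l₂⟩ := hcov
    refine ⟨ν₁ + ν₂, Submodule.add_mem _ hν₁ hν₂, fun x => ?_⟩
    have l₁ := l₁ x
    have l₂ := l₂ x
    have h2 : ind (castleSet 𝒬.S fun i => interior (𝒬.V i))ᶜ x ≤
        (1 - ind 𝒬.covered x) + ind ((P : Set G) • (⋃ j, U j)ᶜ) x := by
      have hn1 := ind_nonneg ((P : Set G) • (⋃ j, U j)ᶜ) x
      have hn2 := ind_le_one 𝒬.covered x
      by_cases hx : x ∈ (castleSet 𝒬.S fun i => interior (𝒬.V i))ᶜ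
      · rw [ind_of_mem hx]
        rcases hsub hx with h | h
        · rw [ind_of_notMem h]; linarith
        · rw [ind_of_mem h]; linarith
      · rw [ind_of_notMem hx]; linarith
    have h3 : (P.card : ℝ) * (ε / 64 / P.card) = ε / 64 :=
      mul_div_cancel₀ _ (by linarith)
    have h4 : ε / 64 / P.card ≤ ε / 64 := div_le_self (by positivity) hPcard
    have h4' : 0 ≤ ε / 64 / P.card := by positivity
    have h5 : (1 - ε / 16) ^ n * (1 - ind (QuasiTiling.empty G X (ε / 16)).covered x -
        (2 * (ε / 128) + ε / 64 / P.card)) ≤ (1 - ε / 16) ^ n := by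
      refine mul_le_of_le_one_right (pow_nonneg (by linarith) _) ?_
      linarith [ind_nonneg (QuasiTiling.empty G X (ε / 16)).covered x]
    rw [hlen] at l₂
    simp only [Pi.add_apply]
    linarith

/-- Almost finiteness passes from an infinite normal subgroup to the whole group, here in terms of
castles with an arbitrary finite index set and `ε ≤ 1`. -/
theorem exists_castle_dynSubequiv {H : Subgroup G} [H.Normal] [Infinite H]
    (hG : IsAmenableGroup G) (hfree : ∀ (g : G) (x : X), g • x = x → g = 1)
    (hH : IsAlmostFinite H X) {K : Finset G} (hK : K.Nonempty) {ε : ℝ} (hε : 0 < ε)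
    (hε1 : ε ≤ 1) :
    ∃ (ι : Type u) (_ : Fintype ι) (S : ι → Finset G) (V : ι → Set X),
      (∀ i, IsInvariantFor K ε (S i)) ∧ (∀ i, IsOpen (V i)) ∧ IsCastle S V ∧
      (∀ i, ∀ s ∈ S i, Metric.diam (s • V i) < ε) ∧ ∃ S' : ι → Finset G, (∀ i, S' i ⊆ S i) ∧
        (∀ i, ((S' i).card : ℝ) < ε * (S i).card) ∧
        DynSubequiv G (castleSet S V)ᶜ (castleSet S' V) := by
  -- Shapes with more than `2 / ε` elements leave room to round `ε / 2 * (S i).card` up and stay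
  -- below `ε * (S i).card`.
  obtain ⟨M, hM⟩ := exists_nat_gt (2 / ε)
  rw [div_lt_iff₀ hε] at hM
  obtain ⟨ι, _, S, V, hinv, hopen, hcastle, hdiam, hcard, hsparse⟩ :=
    exists_castle_sparse_compl (X := X) hG hfree hH hK hε hε1 M
  have hS' : ∀ i, ∃ T ⊆ S i, ε / 2 * (S i).card ≤ T.card ∧ (T.card : ℝ) < ε * (S i).card := by
    intro i
    have h1 : (2 : ℝ) < (S i).card * ε := hM.trans_le (by gcongr; exact hcard i)
    have h2 : (⌈ε / 2 * (S i).card⌉₊ : ℝ) < ε / 2 * (S i).card + 1 :=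
      Nat.ceil_lt_add_one (by positivity)
    have h3 : ⌈ε / 2 * (S i).card⌉₊ ≤ (S i).card := Nat.ceil_le.2 (by
      refine mul_le_of_le_one_left (Nat.cast_nonneg _) (by linarith))
    obtain ⟨T, hT, hTc⟩ := Finset.exists_subset_card_eq h3
    refine ⟨T, hT, ?_, ?_⟩
    · rw [hTc]; exact Nat.le_ceil _
    · rw [hTc]; linarith
  choose S' hS'S hS'l hS'u using hS'
  refine ⟨ι, inferInstance, S, V, hinv, hopen, hcastle, hdiam, S', hS'S, hS'u, ?_⟩
  have hB : AvgLE (⊤ : Subgroup G) (fun x => ε / 2 * ind (castleSet S V) x)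
      (ind (castleSet S' V)) := by
    refine ((AvgLE.ind_castleSet_le fun _ _ _ => Subgroup.mem_top _).const_mul
      (by positivity)).trans ((AvgLE.of_le fun x => ?_).trans
      ((hcastle.subset hS'S).le_ind_castleSet fun _ _ _ => Subgroup.mem_top _))
    rw [Finset.mul_sum]
    refine Finset.sum_le_sum fun i _ => ?_
    rw [← mul_assoc]
    exact mul_le_mul_of_nonneg_right (hS'l i) (ind_nonneg _ _)
  have hAB : AvgLE (⊤ : Subgroup G) (fun x => ind (castleSet S V)ᶜ x + ε / 16)
      (ind (castleSet S' V)) := by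
    obtain ⟨ν₁, hν₁, l₁⟩ := hB
    obtain ⟨ν₂, hν₂, l₂⟩ := hsparse.const_mul (c := 1 + ε / 2) (by positivity)
    refine ⟨ν₁ + ν₂, Submodule.add_mem _ hν₁ hν₂, fun x => ?_⟩
    have l₁ : ε / 2 * ind (castleSet S V) x ≤ ind (castleSet S' V) x + ν₁ x := l₁ x
    have l₂ : (1 + ε / 2) * ind (castleSet S V)ᶜ x ≤ (1 + ε / 2) * (ε / 8) + ν₂ x := l₂ x
    have h1 : ind (castleSet S V) x = 1 - ind (castleSet S V)ᶜ x := by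
      by_cases hx : x ∈ castleSet S V
      · rw [ind_of_mem hx, ind_of_notMem (by simpa using hx), sub_zero]
      · rw [ind_of_notMem hx, ind_of_mem (by simpa using hx), sub_self]
    rw [h1] at l₁
    simp only [Pi.add_apply]
    nlinarith [mul_le_mul_of_nonneg_left hε1 hε.le]
  obtain ⟨K₁, -, η, hη, hsum⟩ := hAB.sum_le (by positivity)
  -- The element `1` only serves to make the set nonempty, as amenability demands.
  obtain ⟨F, hF⟩ := hG (insert 1 K₁) (Finset.insert_nonempty _ _) η hη
  refine dynSubequiv_of_count_lt hH (isOpen_castleSet hopen).isClosed_compl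
    (isOpen_castleSet hopen) (F := F) fun x => ?_
  have h1 := hsum F (fun k hk => hF.card_smul_sdiff (Finset.mem_insert_of_mem hk)) x
  have h2 : (0 : ℝ) < F.card := by exact_mod_cast Finset.card_pos.2 hF.nonempty
  have h3 : 0 < ε / 16 / 2 * (F.card : ℝ) := by positivity
  have h4 : ∑ e ∈ F, ind (castleSet S V)ᶜ (e • x) < ∑ e ∈ F, ind (castleSet S' V) (e • x) := by
    linarith
  rw [sum_ind_smul, sum_ind_smul] at h4
  exact_mod_cast h4

end Main

theorem theoremA {G X : Type*} [Group G] [Countable G]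
    [MetricSpace X] [CompactSpace X] [MulAction G X] [ContinuousConstSMul G X]
    (hG : IsAmenableGroup G)
    (hfree : ∀ (g : G) (x : X), g • x = x → g = 1)
    (H : Subgroup G) [H.Normal] [Infinite H]
    (hH : IsAlmostFinite H X) :
    IsAlmostFinite G X := by
  intro K hK ε hε
  obtain ⟨ι, _, S, V, hinv, hopen, hcastle, hdiam, S', hS', hcard, hsub⟩ :=
    exists_castle_dynSubequiv (X := X) hG hfree hH hK (ε := min ε 1) (by positivity)
      (min_le_right _ _)
  let e := (Fintype.equivFin ι).symm
  have hset : ∀ T : ι → Finset G, (⋃ i, ⋃ s ∈ T (e i), s • V (e i)) = castleSet T V := fun T =>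
    e.surjective.iUnion_comp fun i => ⋃ s ∈ T i, s • V i
  refine ⟨Fintype.card ι, fun i => S (e i), fun i => V (e i),
    fun i => (hinv _).mono_right (min_le_left _ _), fun i => hopen _, ?_,
    fun i s hs => (hdiam _ s hs).trans_le (min_le_left _ _), fun i => S' (e i), fun i => hS' _,
    fun i => (hcard _).trans_le (by gcongr; exact min_le_left _ _), ?_⟩
  · intro i s hs j t ht hne
    refine hcastle _ s hs _ t ht fun he => hne ?_
    simpa using he
  · rw [hset S, hset S']
    exact hsub
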